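/- Let $\mathcal F$ be a smooth foliation of dimension $p$ and codimension $q$ on a smooth (Hausdorff, $\sigma$-compact) manifold $M$ of dimension $p+q$, with normal bundle $N=TM/T\mathcal F$; write $\bar X$ for the section of $N$ defined by a vector field $X$. An adapted chart $(x^1,\dots,x^p,y^1,\dots,y^q)$ is a chart with connected plaques $\{y=\mathrm{const}\}$ in which $T\mathcal F=\ker(dy^1,\dots,dy^q)$. A local function is basic, and a local section $\sum_a\sigma^a\,\overline{\partial/\partial y^a}$ of $N$ is foliated, if the function, respectively the components $\sigma^a$, depend locally (and smoothly) only on $y^1,\dots,y^q$. A local vector field $X$ is an infinitesimal automorphism (i.a.) if $[X,W]$ is tangent to $\mathcal F$ for every local vector field $W$ tangent to $\mathcal F$. A foliated Codazzi structure is a pair $(D,g)$ in which $g$ is a smooth Riemannian metric in $N$ and $D$ is a smooth connection in $N$ such that: * $g$ is foliated: $g(s,t)$ is basic for all foliated sections $s,t$; * $D$ is foliated: for every foliated section $s$, $D_Xs=0$ if $X\in T\mathcal F$, and $D_Xs$ is foliated if $X$ is an i.a.; * $D$ is torsion-free: $D_X\bar Y-D_Y\bar X=\overline{[X,Y]}$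 for all local vector fields $X,Y$; * the Codazzi equation $(D_Xg)(\bar Y,s)=(D_Yg)(\bar X,s)$ holds for all i.a.s $X,Y$ and all foliated sections $s$, where $(D_Xg)(s,t)=X\,g(s,t)-g(D_Xs,t)-g(s,D_Xt)$. It has constant curvature $c$ if $R_D(X,Y)Z=D_XD_YZ-D_YD_XZ-D_{[X,Y]}Z$ satisfies $$R_D(X,Y)Z=c\,\bigl(g(\bar Y,Z)\bar X-g(\bar X,Z)\bar Y\bigr)$$ for all local vector fields $X,Y$ and all local sections $Z$ of $N$. The foliation $\mathcal F$ is transversely Hessian with structure given by $(D,g)$ if 1. $M$ is covered by adapted charts whose changes of transverse coordinates are locally restrictions of affine transformations of $\mathbb R^q$, such that in each of these charts the sections $\overline{\partial/\partial y^a}$ are $D$-parallel and $g=\sum_{a,b}\frac{\partial^2h}{\partial y^a\partial y^b}\,dy^a\,dy^b$ for some smooth function $h$ of $y^1,\dots,y^q$; and 2. there is a (bundle-like) Riemannian metric on $M$ whose restriction to the orthogonal complement of $T\mathcal F$ is $g$. **Proposition.** A foliated Codazzi structure $(D,g)$ on $(M,\mathcal F)$ is of constant curvature $0$ if and only if $\mathcal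 F$ is transversely Hessian with structure given by $(D,g)$. -/

import Mathlib

open Set Topology
open scoped Manifold ContDiff Bundle

/-- The Euclidean space `ℝⁿ`. -/
abbrev Euc (n : ℕ) : Type := EuclideanSpace ℝ (Fin n)

section Foliations

variable {p q : ℕ} {M : Type*} [TopologicalSpace M] [ChartedSpace (Euc (p + q)) M]
  [IsManifold (𝓡 (p + q)) ∞ M]

/-- The derivative `v f` of the function `f` in the direction `v ∈ T_xM`. -/
noncomputable def dirDeriv (f : M → ℝ) (x : M) (v : TangentSpace (𝓡 (p + q)) x) : ℝ :=
  mfderiv (𝓡 (p + q)) 𝓘(ℝ, ℝ) f x v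

/-- `X` is a smooth vector field on the set `U` (in use, `U` is open). Its values off `U` are
irrelevant. -/
def IsSmoothField (U : Set M) (X : ∀ x : M, TangentSpace (𝓡 (p + q)) x) : Prop :=
  ContMDiffOn (𝓡 (p + q)) (𝓡 (p + q)).tangent ∞
    (fun x => (⟨x, X x⟩ : TangentBundle (𝓡 (p + q)) M)) U

/-- A local coordinate system `φ = (x¹, …, xᵖ, y¹, …, y^q)` is adapted to the field `T` of tangent
subspaces if it is smooth with smooth inverse, `T` is the kernel of `(dy¹, …, dy^q)` on its domain,
and its plaques (the fibres of the submersion `(y¹, …, y^q)`) are connected. -/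
structure IsAdaptedChart (T : ∀ x : M, Submodule ℝ (TangentSpace (𝓡 (p + q)) x))
    (φ : OpenPartialHomeomorph M (Euc p × Euc q)) : Prop where
  contMDiffOn : ContMDiffOn (𝓡 (p + q)) 𝓘(ℝ, Euc p × Euc q) ∞ φ φ.source
  contMDiffOn_symm : ContMDiffOn 𝓘(ℝ, Euc p × Euc q) (𝓡 (p + q)) ∞ φ.symm φ.target
  mem_iff : ∀ x ∈ φ.source, ∀ v : TangentSpace (𝓡 (p + q)) x,
    v ∈ T x ↔ mfderiv (𝓡 (p + q)) 𝓘(ℝ, Euc q) (fun z => (φ z).2) x v = 0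
  plaques : ∀ c : Euc q, IsPreconnected {z ∈ φ.source | (φ z).2 = c}

variable (p q M) in
/-- A smooth foliation of dimension `p` and codimension `q` on the `(p + q)`-manifold `M`: a field
of tangent subspaces for which there are adapted charts around every point. -/
structure Foliation where
  /-- The tangent space `T_xℱ` of the leaf through `x`. -/
  tangent : ∀ x : M, Submodule ℝ (TangentSpace (𝓡 (p + q)) x)
  exists_chart : ∀ x : M, ∃ φ : OpenPartialHomeomorph M (Euc p × Euc q),
    x ∈ φ.source ∧ IsAdaptedChart tangent φ

namespace Foliation

/-- The fibre at `x` of the normal bundle `N(M, ℱ) = TM / Tℱ`. -/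
abbrev Normal (F : Foliation p q M) (x : M) : Type := TangentSpace (𝓡 (p + q)) x ⧸ F.tangent x

/-- `X̄`: the section of the normal bundle defined by the vector field `X`. -/
noncomputable def bar (F : Foliation p q M) (X : ∀ x : M, TangentSpace (𝓡 (p + q)) x) : ∀ x : M, F.Normal x :=
  fun x => (F.tangent x).mkQ (X x)

/-- `s` is a smooth section over `U` of the normal bundle: locally it is the class of a smooth
vector field. -/
def IsSmoothSection (F : Foliation p q M) (U : Set M) (s : ∀ x : M, F.Normal x) : Prop :=
  ∀ x ∈ U, ∃ V : Set M, IsOpen V ∧ x ∈ V ∧ V ⊆ U ∧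
    ∃ Y : ∀ x : M, TangentSpace (𝓡 (p + q)) x, IsSmoothField V Y ∧ ∀ z ∈ V, s z = F.bar Y z

/-- The class at `x` in the normal bundle of the coordinate vector `∑ cᵃ ∂/∂yᵃ` of the chart
`φ`. -/
noncomputable def coord (F : Foliation p q M) (φ : OpenPartialHomeomorph M (Euc p × Euc q))
    (c : Euc q) (x : M) : F.Normal x :=
  (F.tangent x).mkQ
    (mfderiv 𝓘(ℝ, Euc p × Euc q) (𝓡 (p + q)) φ.symm (φ x) ((0, c) : Euc p × Euc q) :
      Euc (p + q))

/-- `f` is a basic function on `U`: locally, it is a smooth function of the transverse coordinates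
alone. -/
def IsBasic (F : Foliation p q M) (U : Set M) (f : M → ℝ) : Prop :=
  ∀ x ∈ U, ∃ φ : OpenPartialHomeomorph M (Euc p × Euc q),
    x ∈ φ.source ∧ φ.source ⊆ U ∧ IsAdaptedChart F.tangent φ ∧
    ∃ u : Euc q → ℝ, ContDiffOn ℝ ∞ u (Prod.snd '' φ.target) ∧
      ∀ z ∈ φ.source, f z = u (φ z).2

/-- `s` is a foliated section over `U` of the normal bundle: locally `s = ∑ σᵃ ∂̄/∂yᵃ`, where the
components `σᵃ` are smooth functions of the transverse coordinates alone. -/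
def IsFoliatedSection (F : Foliation p q M) (U : Set M) (s : ∀ x : M, F.Normal x) : Prop :=
  ∀ x ∈ U, ∃ φ : OpenPartialHomeomorph M (Euc p × Euc q),
    x ∈ φ.source ∧ φ.source ⊆ U ∧ IsAdaptedChart F.tangent φ ∧
    ∃ σ : Euc q → Euc q, ContDiffOn ℝ ∞ σ (Prod.snd '' φ.target) ∧
      ∀ z ∈ φ.source, s z = F.coord φ (σ (φ z).2) z

/-- `X` is an infinitesimal automorphism (i.a.) of the foliation on `U`: it is smooth, and its
bracket with every local vector field tangent to the leaves is tangent to the leaves. -/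
def IsInfinitesimalAut (F : Foliation p q M) (U : Set M)
    (X : ∀ x : M, TangentSpace (𝓡 (p + q)) x) : Prop :=
  IsSmoothField U X ∧
    ∀ V : Set M, IsOpen V → V ⊆ U → ∀ W : ∀ x : M, TangentSpace (𝓡 (p + q)) x,
      IsSmoothField V W → (∀ x ∈ V, W x ∈ F.tangent x) →
      ∀ x ∈ V, VectorField.mlieBracket (𝓡 (p + q)) X W x ∈ F.tangent x

end Foliation

/-- A smooth Riemannian metric in the normal bundle. -/
structure NormalMetric (F : Foliation p q M) where
  inner : ∀ x : M, F.Normal x →ₗ[ℝ] F.Normal x →ₗ[ℝ] ℝ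
  symm : ∀ (x : M) (v w : F.Normal x), inner x v w = inner x w v
  pos : ∀ (x : M) (v : F.Normal x), v ≠ 0 → 0 < inner x v v
  smooth : ∀ U : Set M, IsOpen U → ∀ s t : ∀ x : M, F.Normal x,
    F.IsSmoothSection U s → F.IsSmoothSection U t →
    ContMDiffOn (𝓡 (p + q)) 𝓘(ℝ, ℝ) ∞ (fun x => inner x (s x) (t x)) U

/-- A smooth (linear) connection in the normal bundle; `D s x v` is the covariant derivative
`D_v s` of the section `s` at `x` in the direction `v ∈ T_xM`. As for Mathlib's covariant
derivatives, `D` takes all sections as arguments, but the axioms only concern `D s` on open sets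
where `s` is smooth; they imply that `D s x` depends only on the germ of `s` at `x`. -/
structure NormalConnection (F : Foliation p q M) where
  toFun : (∀ x : M, F.Normal x) → ∀ x : M, TangentSpace (𝓡 (p + q)) x →ₗ[ℝ] F.Normal x
  add : ∀ U : Set M, IsOpen U → ∀ s t : ∀ x : M, F.Normal x,
    F.IsSmoothSection U s → F.IsSmoothSection U t →
    ∀ x ∈ U, ∀ v, toFun (fun z => s z + t z) x v = toFun s x v + toFun t x v
  leibniz : ∀ U : Set M, IsOpen U → ∀ (f : M → ℝ) (s : ∀ x : M, F.Normal x),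
    ContMDiffOn (𝓡 (p + q)) 𝓘(ℝ, ℝ) ∞ f U → F.IsSmoothSection U s →
    ∀ x ∈ U, ∀ v, toFun (fun z => f z • s z) x v
      = f x • toFun s x v + dirDeriv f x v • s x
  smooth : ∀ U : Set M, IsOpen U → ∀ (X : ∀ x : M, TangentSpace (𝓡 (p + q)) x)
    (s : ∀ x : M, F.Normal x), IsSmoothField U X → F.IsSmoothSection U s →
    F.IsSmoothSection U (fun x => toFun s x (X x))

/-- The metric is foliated: it is basic on foliated sections, that is, its coefficients in adapted
charts depend on the transverse coordinates alone. -/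
def NormalMetric.IsFoliated {F : Foliation p q M} (g : NormalMetric F) : Prop :=
  ∀ U : Set M, IsOpen U → ∀ s t : ∀ x : M, F.Normal x,
    F.IsFoliatedSection U s → F.IsFoliatedSection U t →
    F.IsBasic U (fun x => g.inner x (s x) (t x))

namespace NormalConnection

variable {F : Foliation p q M}

/-- `D_X s = 0` for `X` tangent to the leaves and `s` foliated. -/
def IsNormal (D : NormalConnection F) : Prop :=
  ∀ U : Set M, IsOpen U → ∀ s : ∀ x : M, F.Normal x, F.IsFoliatedSection U s →
    ∀ x ∈ U, ∀ v ∈ F.tangent x, D.toFun s x v = 0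

/-- `D` is a foliated connection: it is normal, and `D_X s` is a foliated section for every
infinitesimal automorphism `X` and every foliated section `s`. -/
def IsFoliated (D : NormalConnection F) : Prop :=
  D.IsNormal ∧ ∀ U : Set M, IsOpen U → ∀ (X : ∀ x : M, TangentSpace (𝓡 (p + q)) x)
    (s : ∀ x : M, F.Normal x), F.IsInfinitesimalAut U X → F.IsFoliatedSection U s →
    F.IsFoliatedSection U (fun x => D.toFun s x (X x))

/-- `D_X Ȳ - D_Y X̄` is the class of `[X, Y]`. -/
def IsTorsionFree (D : NormalConnection F) : Prop :=
  ∀ U : Set M, IsOpen U → ∀ X Y : ∀ x : M, TangentSpace (𝓡 (p + q)) x,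
    IsSmoothField U X → IsSmoothField U Y → ∀ x ∈ U,
    D.toFun (F.bar Y) x (X x) - D.toFun (F.bar X) x (Y x)
      = F.bar (VectorField.mlieBracket (𝓡 (p + q)) X Y) x

/-- The curvature `R_D(X, Y) s = D_X D_Y s - D_Y D_X s - D_{[X, Y]} s`. -/
noncomputable def curvature (D : NormalConnection F)
    (X Y : ∀ x : M, TangentSpace (𝓡 (p + q)) x) (s : ∀ x : M, F.Normal x) (x : M) : F.Normal x :=
  D.toFun (fun z => D.toFun s z (Y z)) x (X x) - D.toFun (fun z => D.toFun s z (X z)) x (Y x)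
    - D.toFun s x (VectorField.mlieBracket (𝓡 (p + q)) X Y x)

/-- `(D_X g)(s, t) = X g(s, t) - g(D_X s, t) - g(s, D_X t)`. -/
noncomputable def derivMetric (D : NormalConnection F) (g : NormalMetric F)
    (X : ∀ x : M, TangentSpace (𝓡 (p + q)) x) (s t : ∀ x : M, F.Normal x) (x : M) : ℝ :=
  dirDeriv (fun z => g.inner z (s z) (t z)) x (X x)
    - g.inner x (D.toFun s x (X x)) (t x) - g.inner x (s x) (D.toFun t x (X x))

end NormalConnection

variable {F : Foliation p q M}

/-- `(D, g)` is a foliated Codazzi structure: `D` is torsion-free, `D` and `g` are foliated, and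
`(D_X g)(Ȳ, s) = (D_Y g)(X̄, s)` for infinitesimal automorphisms `X`, `Y` and foliated
sections `s`. -/
structure IsFoliatedCodazzi (D : NormalConnection F) (g : NormalMetric F) : Prop where
  torsionFree : D.IsTorsionFree
  foliated_connection : D.IsFoliated
  foliated_metric : g.IsFoliated
  codazzi : ∀ U : Set M, IsOpen U → ∀ (X Y : ∀ x : M, TangentSpace (𝓡 (p + q)) x)
    (s : ∀ x : M, F.Normal x), F.IsInfinitesimalAut U X → F.IsInfinitesimalAut U Y →
    F.IsFoliatedSection U s →
    ∀ x ∈ U, D.derivMetric g X (F.bar Y) s x = D.derivMetric g Y (F.bar X) s x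

/-- `R_D(X, Y) Z = c (g(Y, Z) X - g(X, Z) Y)` for all local smooth sections `X`, `Y`, `Z` of the
normal bundle; the first two are written as classes of vector fields. -/
def HasConstantCurvature (D : NormalConnection F) (g : NormalMetric F) (c : ℝ) : Prop :=
  ∀ U : Set M, IsOpen U → ∀ (X Y : ∀ x : M, TangentSpace (𝓡 (p + q)) x)
    (Z : ∀ x : M, F.Normal x), IsSmoothField U X → IsSmoothField U Y → F.IsSmoothSection U Z →
    ∀ x ∈ U, D.curvature X Y Z x
      = c • (g.inner x (F.bar Y x) (Z x) • F.bar X x - g.inner x (F.bar X x) (Z x) • F.bar Y x)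

/-- A transversely affine atlas of the foliation: adapted charts that cover `M` and whose changes
of transverse coordinates are (locally) restrictions of affine transformations of `ℝ^q`. -/
structure IsTransverselyAffineAtlas (F : Foliation p q M)
    (A : Set (OpenPartialHomeomorph M (Euc p × Euc q))) : Prop where
  adapted : ∀ φ ∈ A, IsAdaptedChart F.tangent φ
  covers : ∀ x : M, ∃ φ ∈ A, x ∈ φ.source
  affine : ∀ φ ∈ A, ∀ ψ ∈ A, ∀ x ∈ φ.source ∩ ψ.source,
    ∃ k : Euc q ≃ᵃ[ℝ] Euc q, ∀ᶠ z in 𝓝 x, (ψ z).2 = k (φ z).2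

/-- The horizontal part of the Riemannian metric `G` of `M` (its restriction to the orthogonal
complement of the leaves) is the metric `g` of the normal bundle. When `g` is foliated, this says
that `G` is bundle-like with transverse part `g`. -/
def HasHorizontalPart
    (G : Bundle.ContMDiffRiemannianMetric (𝓡 (p + q)) ∞ (Euc (p + q))
      (fun x : M => TangentSpace (𝓡 (p + q)) x)) (g : NormalMetric F) : Prop :=
  ∀ (x : M) (v w : TangentSpace (𝓡 (p + q)) x),
    (∀ u ∈ F.tangent x, G.inner x u v = 0) → (∀ u ∈ F.tangent x, G.inner x u w = 0) →
    G.inner x v w = g.inner x ((F.tangent x).mkQ v) ((F.tangent x).mkQ w)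

/-- The foliation is transversely Hessian with structure `(D, g)`: there is a transversely affine
atlas whose transverse coordinate sections `∂̄/∂yᵃ` are `D`-parallel, in each of its charts
`g = ∑ (∂²h/∂yᵃ∂yᵇ) dyᵃ dyᵇ` for a smooth function `h` of the transverse coordinates, and `g` is
the horizontal part of a Riemannian metric on `M`. -/
def IsTransverselyHessian (D : NormalConnection F)
    (g : NormalMetric F) : Prop :=
  (∃ A : Set (OpenPartialHomeomorph M (Euc p × Euc q)), IsTransverselyAffineAtlas F A ∧
    ∀ φ ∈ A,
      (∀ c : Euc q, ∀ x ∈ φ.source, ∀ v, D.toFun (F.coord φ c) x v = 0) ∧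
      ∃ h : Euc q → ℝ, ContDiffOn ℝ ∞ h (Prod.snd '' φ.target) ∧
        ∀ x ∈ φ.source, ∀ a b : Euc q,
          g.inner x (F.coord φ a x) (F.coord φ b x)
            = fderiv ℝ (fun y => fderiv ℝ h y a) (φ x).2 b) ∧
  ∃ G : Bundle.ContMDiffRiemannianMetric (𝓡 (p + q)) ∞ (Euc (p + q))
      (fun x : M => TangentSpace (𝓡 (p + q)) x), HasHorizontalPart G g

end Foliations

/-! Flat to Hessian. In an adapted chart a normal connection is given by Christoffel symbols `γ`
which pair only with transverse directions (`exists_isChristoffel`). Vanishing curvature in one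
leafwise and one transverse direction says that `γ` is constant along the plaques (`eq_of_flat`), so
on a product of balls everything descends to a flat torsion-free connection on an open set of `ℝ^q`.

Such a connection has affine coordinates (`exists_affineCoordinates`). A parallel coframe `A` solves
the linear total differential equation `dA = A γ`, whose integrability condition is flatness;
symmetry of `γ` makes `A` closed, so `A = dk`, and `k` gives the coordinates. Local solvability is
the linear Frobenius theorem `exists_hasFDerivAt_of_flat`, proved by Picard iteration along rays.
Changing the transverse coordinates by `k` produces an adapted chart with parallel coordinate
sections (`exists_isParallelChart`). Two such charts differ by an affine map, because the Jacobian
between two parallel frames is locally constant (`exists_affineEquiv_of_isParallelChart`).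

In a parallel chart the Codazzi equation reads `∂_a g_bc = ∂_b g_ac`, and `g` is constant along
plaques. Two applications of the Poincaré lemma on a convex image then write `g` as a Hessian
(`exists_hessian`). The Riemannian metric on `M` is glued by a partition of unity, after a smooth
projection onto the leaf directions has been fixed (`exists_hasHorizontalPart`).

Hessian to flat. In a parallel chart `D` differentiates components, so its curvature is the
commutator of `X` and `Y` minus `[X, Y]` acting on functions, which is zero
(`curvature_eq_zero_of_isParallelChart`). -/

set_option maxSynthPendingDepth 3
set_option linter.unusedSectionVars false

/-! ### Linear total differential equations: the Picard operator along rays -/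

section TotalDifferentialEquations

open Metric MeasureTheory

variable {E V : Type*} [NormedAddCommGroup E] [NormedSpace ℝ E]
  [NormedAddCommGroup V] [NormedSpace ℝ V]

/-- The integral along rays whose fixed points are the candidate solutions of
`df y w = Γ y w (f y)`, `f 0 = v₀`. -/
noncomputable def radialPicard (Γ : E → E →L[ℝ] V →L[ℝ] V) (v₀ : V) (f : E → V) (y : E) : V :=
  v₀ + ∫ t in (0 : ℝ)..1, Γ (t • y) y (f (t • y))

/-- The derivative in `x` of the integrand `Γ (t • x) x (f (t • x))` of `radialPicard`. -/
noncomputable def radialPicardDeriv (Γ : E → E →L[ℝ] V →L[ℝ] V) (f : E → V) (x : E) (t : ℝ) :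
    E →L[ℝ] V :=
  t • ((ContinuousLinearMap.apply ℝ V (f (t • x))).comp
      ((ContinuousLinearMap.apply ℝ (V →L[ℝ] V) x).comp (fderiv ℝ Γ (t • x)))) +
    (Γ (t • x)).flip (f (t • x)) + t • (Γ (t • x) x).comp (fderiv ℝ f (t • x))

variable {Γ : E → E →L[ℝ] V →L[ℝ] V} {f : E → V} {r : ℝ}

lemma smul_mem_ball_zero {x : E} (hx : x ∈ ball (0 : E) r) {t : ℝ} (h0 : 0 ≤ t) (h1 : t ≤ 1) :
    t • x ∈ ball (0 : E) r := by
  rw [mem_ball_zero_iff] at *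
  rw [norm_smul, Real.norm_of_nonneg h0]
  nlinarith [norm_nonneg x]

lemma hasFDerivAt_radialPicard_integrand (hΓ : DifferentiableOn ℝ Γ (ball 0 r))
    (hf : DifferentiableOn ℝ f (ball 0 r)) {x : E} (hx : x ∈ ball (0 : E) r) {t : ℝ}
    (h0 : 0 ≤ t) (h1 : t ≤ 1) :
    HasFDerivAt (fun x => Γ (t • x) x (f (t • x))) (radialPicardDeriv Γ f x t) x := by
  have hm := isOpen_ball.mem_nhds (smul_mem_ball_zero hx h0 h1)
  have hs : HasFDerivAt (fun x : E => t • x) (t • ContinuousLinearMap.id ℝ E) x :=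
    (hasFDerivAt_id x).const_smul t
  have h₁ := (hΓ.differentiableAt hm).hasFDerivAt.comp x hs
  have h₂ := (hf.differentiableAt hm).hasFDerivAt.comp x hs
  refine ((h₁.clm_apply (hasFDerivAt_id x)).clm_apply h₂).congr_fderiv ?_
  ext w
  simp [radialPicardDeriv]
  abel

/-- The bound is uniform in `x` and `t`, so it serves as the dominating function for differentiation
under the integral sign. -/
lemma norm_radialPicardDeriv_le {C C' K K' : ℝ} (hC : ∀ y ∈ ball (0 : E) r, ‖Γ y‖ ≤ C)
    (hC' : ∀ y ∈ ball (0 : E) r, ‖fderiv ℝ Γ y‖ ≤ C') (hK : ∀ y ∈ ball (0 : E) r, ‖f y‖ ≤ K)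
    (hK' : ∀ y ∈ ball (0 : E) r, ‖fderiv ℝ f y‖ ≤ K') {x : E} (hx : x ∈ ball (0 : E) r) {t : ℝ}
    (h0 : 0 ≤ t) (h1 : t ≤ 1) :
    ‖radialPicardDeriv Γ f x t‖ ≤ C' * r * K + C * K + C * r * K' := by
  have hm := smul_mem_ball_zero hx h0 h1
  have hxr : ‖x‖ ≤ r := (mem_ball_zero_iff.1 hx).le
  have hr : 0 ≤ r := (norm_nonneg x).trans hxr
  have c0 : 0 ≤ C := (norm_nonneg _).trans (hC _ hm)
  have c1 : 0 ≤ C' := (norm_nonneg _).trans (hC' _ hm)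
  have k0 : 0 ≤ K := (norm_nonneg _).trans (hK _ hm)
  have k1 : 0 ≤ K' := (norm_nonneg _).trans (hK' _ hm)
  refine ContinuousLinearMap.opNorm_le_bound _ (by positivity) fun w => ?_
  have e1 : ‖fderiv ℝ Γ (t • x) w x (f (t • x))‖ ≤ C' * ‖w‖ * r * K :=
    ((fderiv ℝ Γ (t • x) w x).le_of_opNorm_le_of_le
      ((fderiv ℝ Γ (t • x) w).le_of_opNorm_le_of_le
        ((fderiv ℝ Γ (t • x)).le_of_opNorm_le (hC' _ hm) w) hxr) (hK _ hm))
  have e2 : ‖Γ (t • x) w (f (t • x))‖ ≤ C * ‖w‖ * K :=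
    (Γ (t • x) w).le_of_opNorm_le_of_le ((Γ (t • x)).le_of_opNorm_le (hC _ hm) w) (hK _ hm)
  have e3 : ‖Γ (t • x) x (fderiv ℝ f (t • x) w)‖ ≤ C * r * (K' * ‖w‖) :=
    (Γ (t • x) x).le_of_opNorm_le_of_le ((Γ (t • x)).le_of_opNorm_le_of_le (hC _ hm) hxr)
      ((fderiv ℝ f (t • x)).le_of_opNorm_le (hK' _ hm) w)
  have et : ∀ u : V, ‖t • u‖ ≤ ‖u‖ := fun u => by
    rw [norm_smul, Real.norm_of_nonneg h0]; nlinarith [norm_nonneg u]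
  simp only [radialPicardDeriv, _root_.add_apply, _root_.smul_apply,
    ContinuousLinearMap.comp_apply, ContinuousLinearMap.apply_apply,
    ContinuousLinearMap.flip_apply]
  refine (norm_add₃_le).trans ?_
  have := (et _).trans e1
  have := (et _).trans e3
  linarith

section

lemma continuousOn_comp_ray {G : Type*} [TopologicalSpace G] {u : E → G}
    (hu : ContinuousOn u (ball 0 r)) {x : E} (hx : x ∈ ball (0 : E) r) :
    ContinuousOn (fun t : ℝ => u (t • x)) (uIcc 0 1) := by
  refine hu.comp (by fun_prop) fun t ht => ?_
  rw [uIcc_of_le zero_le_one] at ht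
  exact smul_mem_ball_zero hx ht.1 ht.2

lemma aestronglyMeasurable_uIoc {G : Type*} [TopologicalSpace G]
    [TopologicalSpace.PseudoMetrizableSpace G]
    {u : ℝ → G} (hu : ContinuousOn u (uIcc 0 1)) :
    AEStronglyMeasurable u (volume.restrict (uIoc 0 1)) :=
  ((hu.mono uIoc_subset_uIcc).aestronglyMeasurable measurableSet_uIoc)

variable [FiniteDimensional ℝ E] [FiniteDimensional ℝ V]

/-- The Picard iterates are only known to be differentiable, so `fderiv ℝ f` need not be continuous
along the ray. Measurability of derivatives takes the place of continuity. -/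
lemma aestronglyMeasurable_radialPicardDeriv (hΓ : ContDiffOn ℝ 1 Γ (ball 0 r))
    (hf : DifferentiableOn ℝ f (ball 0 r)) {x : E} (hx : x ∈ ball (0 : E) r) :
    AEStronglyMeasurable (radialPicardDeriv Γ f x) (volume.restrict (uIoc 0 1)) := by
  have hΓ' := hΓ.continuousOn_fderiv_of_isOpen isOpen_ball le_rfl
  have c1 := continuousOn_comp_ray hΓ.continuousOn hx
  have c2 := continuousOn_comp_ray hf.continuousOn hx
  have c3 := continuousOn_comp_ray hΓ' hx
  borelize E
  borelize V
  borelize (E →L[ℝ] V)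
  have c4 : AEStronglyMeasurable (fun t : ℝ => fderiv ℝ f (t • x))
      (volume.restrict (uIoc 0 1)) :=
    ((measurable_fderiv ℝ f).comp (by fun_prop : Measurable
      fun t : ℝ => t • x)).aestronglyMeasurable
  unfold radialPicardDeriv
  refine (aestronglyMeasurable_uIoc (ContinuousOn.add ?_ ?_)).add ?_
  · exact continuousOn_id.smul
      (((ContinuousLinearMap.apply ℝ V).continuous.comp_continuousOn c2).clm_comp
        (continuousOn_const.clm_comp c3))
  · exact ((ContinuousLinearMap.flipₗᵢ ℝ E V V).continuous.comp_continuousOn c1).clm_apply c2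
  · have c5 : ContinuousOn (fun t : ℝ =>
        ContinuousLinearMap.compL ℝ E V V (t • Γ (t • x) x)) (uIcc 0 1) :=
      (ContinuousLinearMap.compL ℝ E V V).continuous.comp_continuousOn
        (continuousOn_id.smul (c1.clm_apply continuousOn_const))
    have := (aestronglyMeasurable_uIoc c5)
    exact ((ContinuousLinearMap.id ℝ ((E →L[ℝ] V) →L[ℝ] (E →L[ℝ] V))).aestronglyMeasurable_comp₂
      this c4).congr (by filter_upwards with t; ext; simp)

/-- The defect `df - Γ f` of the equation is contracted by `radialPicard`. -/
lemma radialPicard_hasFDerivAt {C C' K K' ε : ℝ} (hΓ : ContDiffOn ℝ 1 Γ (ball 0 r))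
    (hC : ∀ y ∈ ball (0 : E) r, ‖Γ y‖ ≤ C) (hC' : ∀ y ∈ ball (0 : E) r, ‖fderiv ℝ Γ y‖ ≤ C')
    (hf : DifferentiableOn ℝ f (ball 0 r)) (hK : ∀ y ∈ ball (0 : E) r, ‖f y‖ ≤ K)
    (hK' : ∀ y ∈ ball (0 : E) r, ‖fderiv ℝ f y‖ ≤ K')
    (hflat : ∀ y ∈ ball (0 : E) r, ∀ a b v,
      fderiv ℝ Γ y a b v + Γ y b (Γ y a v) = fderiv ℝ Γ y b a v + Γ y a (Γ y b v))
    (hε : ∀ y ∈ ball (0 : E) r, ‖fderiv ℝ f y - (Γ y).flip (f y)‖ ≤ ε) (v₀ : V) {y : E}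
    (hy : y ∈ ball (0 : E) r) :
    ∃ g', HasFDerivAt (radialPicard Γ v₀ f) g' y ∧ ‖g' - (Γ y).flip (f y)‖ ≤ 2 * (C * r) * ε := by
  have hΓd := hΓ.differentiableOn one_ne_zero
  have hcont : ∀ x ∈ ball (0 : E) r,
      ContinuousOn (fun t : ℝ => Γ (t • x) x (f (t • x))) (uIcc 0 1) := fun x hx =>
    ((continuousOn_comp_ray hΓ.continuousOn hx).clm_apply continuousOn_const).clm_apply
      (continuousOn_comp_ray hf.continuousOn hx)
  have hu : ∀ t ∈ uIoc (0 : ℝ) 1, 0 ≤ t ∧ t ≤ 1 := fun t ht => by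
    rw [uIoc_of_le zero_le_one] at ht; exact ⟨ht.1.le, ht.2⟩
  obtain ⟨hint, hder⟩ := intervalIntegral.hasFDerivAt_integral_of_dominated_loc_of_lip
    (μ := volume) (a := 0) (b := 1) (F := fun x t => Γ (t • x) x (f (t • x)))
    (F' := radialPicardDeriv Γ f y)
    (bound := fun _ => C' * r * K + C * K + C * r * K') (isOpen_ball.mem_nhds hy)
    (Filter.eventually_of_mem (isOpen_ball.mem_nhds hy) fun x hx =>
      aestronglyMeasurable_uIoc (hcont x hx))
    (hcont y hy).intervalIntegrable (aestronglyMeasurable_radialPicardDeriv hΓ hf hy)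
    (by
      filter_upwards with t ht
      refine Convex.lipschitzOnWith_of_nnnorm_hasFDerivWithin_le (𝕜 := ℝ)
        (f' := fun x => radialPicardDeriv Γ f x t) (fun x hx =>
          (hasFDerivAt_radialPicard_integrand hΓd hf hx (hu t ht).1 (hu t ht).2).hasFDerivWithinAt)
        (fun x hx => ?_) (convex_ball _ _)
      have := norm_radialPicardDeriv_le hC hC' hK hK' hx (hu t ht).1 (hu t ht).2
      rw [← NNReal.coe_le_coe, Real.coe_nnabs, coe_nnnorm]
      exact this.trans (le_abs_self _))
    (by simp)
    (by
      filter_upwards with t ht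
      exact hasFDerivAt_radialPicard_integrand hΓd hf hy (hu t ht).1 (hu t ht).2)
  refine ⟨_, hder.const_add v₀, ?_⟩
  have hr : 0 < r := by
    have := mem_ball_zero_iff.1 hy
    exact (norm_nonneg _).trans_lt this
  have hyr : ‖y‖ ≤ r := (mem_ball_zero_iff.1 hy).le
  have c0 : 0 ≤ C := (norm_nonneg _).trans (hC _ hy)
  have ε0 : 0 ≤ ε := (norm_nonneg _).trans (hε _ hy)
  refine ContinuousLinearMap.opNorm_le_bound _ (by positivity) fun w => ?_
  -- This function runs from `0` to `Γ y w (f y)`, so `Γ y w (f y)` becomes an integral over the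
  -- same ray and can be compared with the derivative of `radialPicard` under the integral sign.
  have hd : ∀ t ∈ uIcc (0 : ℝ) 1, HasDerivAt (fun t : ℝ => t • Γ (t • y) w (f (t • y)))
      (t • (fderiv ℝ Γ (t • y) y w (f (t • y)) + Γ (t • y) w (fderiv ℝ f (t • y) y)) +
        Γ (t • y) w (f (t • y))) t := by
    intro t ht
    rw [uIcc_of_le zero_le_one] at ht
    have hm := isOpen_ball.mem_nhds (smul_mem_ball_zero hy ht.1 ht.2)
    have hs : HasDerivAt (fun t : ℝ => t • y) y t := by
      simpa using (hasDerivAt_id t).smul_const y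
    have h₁ := (hΓd.differentiableAt hm).hasFDerivAt.comp_hasDerivAt t hs
    have h₂ := (hf.differentiableAt hm).hasFDerivAt.comp_hasDerivAt t hs
    have h₃ := (hasDerivAt_id t).smul ((h₁.clm_apply (hasDerivAt_const t w)).clm_apply h₂)
    refine h₃.congr_deriv ?_
    simp
  have hint2 : IntervalIntegrable (fun t : ℝ =>
      t • (fderiv ℝ Γ (t • y) y w (f (t • y)) + Γ (t • y) w (fderiv ℝ f (t • y) y)) +
        Γ (t • y) w (f (t • y))) volume 0 1 := by
    have hΓ' := hΓ.continuousOn_fderiv_of_isOpen isOpen_ball le_rfl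
    have c1 := continuousOn_comp_ray hΓ.continuousOn hy
    have c2 := continuousOn_comp_ray hf.continuousOn hy
    have c3 := continuousOn_comp_ray hΓ' hy
    borelize E
    borelize V
    have c4 : AEStronglyMeasurable (fun t : ℝ => fderiv ℝ f (t • y) y)
        (volume.restrict (uIoc 0 1)) :=
      ((measurable_fderiv_apply_const ℝ f y).comp
        (by fun_prop : Measurable fun t : ℝ => t • y)).aestronglyMeasurable
    have c5 : ContinuousOn (fun t : ℝ => t • fderiv ℝ Γ (t • y) y w (f (t • y)) +
        Γ (t • y) w (f (t • y))) (uIcc 0 1) :=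
      (continuousOn_id.smul (((c3.clm_apply continuousOn_const).clm_apply
        continuousOn_const).clm_apply c2)).add ((c1.clm_apply continuousOn_const).clm_apply c2)
    have c6 : ContinuousOn (fun t : ℝ => t • Γ (t • y) w) (uIcc 0 1) :=
      continuousOn_id.smul (c1.clm_apply continuousOn_const)
    have i6 : IntervalIntegrable (fun t : ℝ => (t • Γ (t • y) w) (fderiv ℝ f (t • y) y))
        volume 0 1 := by
      refine (intervalIntegrable_const (c := C * ‖w‖ * (K' * r))).mono_fun
        ((ContinuousLinearMap.id ℝ (V →L[ℝ] V)).aestronglyMeasurable_comp₂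
          (aestronglyMeasurable_uIoc c6) c4) ?_
      rw [Filter.EventuallyLE, ae_restrict_iff' measurableSet_uIoc]
      filter_upwards with t ht
      have hm := smul_mem_ball_zero hy (hu t ht).1 (hu t ht).2
      have e1 : ‖Γ (t • y) w (fderiv ℝ f (t • y) y)‖ ≤ C * ‖w‖ * (K' * r) :=
        (Γ (t • y) w).le_of_opNorm_le_of_le ((Γ (t • y)).le_of_opNorm_le (hC _ hm) w)
          ((fderiv ℝ f (t • y)).le_of_opNorm_le_of_le (hK' _ hm) hyr)
      rw [_root_.smul_apply, norm_smul, Real.norm_of_nonneg (hu t ht).1]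
      refine le_trans ?_ (le_abs_self _)
      nlinarith [hu t ht, norm_nonneg (Γ (t • y) w (fderiv ℝ f (t • y) y))]
    refine (c5.intervalIntegrable.add i6).congr fun t _ => ?_
    simp only [_root_.smul_apply, smul_add]
    abel
  have hftc := intervalIntegral.integral_eq_sub_of_hasDerivAt hd hint2
  simp only [one_smul, zero_smul, sub_zero] at hftc
  have hiw : IntervalIntegrable (fun t => radialPicardDeriv Γ f y t w) volume 0 1 :=
    ⟨(ContinuousLinearMap.apply ℝ V w).integrable_comp hint.1,
      (ContinuousLinearMap.apply ℝ V w).integrable_comp hint.2⟩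
  rw [_root_.sub_apply, ContinuousLinearMap.intervalIntegral_apply hint,
    ContinuousLinearMap.flip_apply, ← hftc, ← intervalIntegral.integral_sub hiw hint2]
  have key := intervalIntegral.norm_integral_le_of_norm_le_const (a := 0) (b := 1)
    (C := 2 * (C * r) * ε * ‖w‖) (f := fun t : ℝ => radialPicardDeriv Γ f y t w -
      (t • (fderiv ℝ Γ (t • y) y w (f (t • y)) + Γ (t • y) w (fderiv ℝ f (t • y) y)) +
        Γ (t • y) w (f (t • y)))) ?_
  · simpa using key
  intro t ht
  have hm := smul_mem_ball_zero hy (hu t ht).1 (hu t ht).2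
  -- Flatness trades the antisymmetrized derivative of `Γ` for a commutator of `Γ y` and `Γ w`; what
  -- remains of the integrand is linear in the defect `df - Γ f`.
  have hfl := hflat _ hm w y (f (t • y))
  have hval : radialPicardDeriv Γ f y t w -
      (t • (fderiv ℝ Γ (t • y) y w (f (t • y)) + Γ (t • y) w (fderiv ℝ f (t • y) y)) +
        Γ (t • y) w (f (t • y))) =
      t • (Γ (t • y) y ((fderiv ℝ f (t • y) - (Γ (t • y)).flip (f (t • y))) w) -
        Γ (t • y) w ((fderiv ℝ f (t • y) - (Γ (t • y)).flip (f (t • y))) y)) := by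
    simp only [radialPicardDeriv, _root_.add_apply, _root_.smul_apply,
      ContinuousLinearMap.comp_apply, ContinuousLinearMap.apply_apply,
      ContinuousLinearMap.flip_apply, _root_.sub_apply, map_sub]
    rw [← sub_eq_zero] at hfl
    have := congrArg (fun u => t • u) hfl
    simp only [smul_add, smul_sub, smul_zero] at this ⊢
    rw [← sub_eq_zero, ← this]
    abel
  rw [hval, norm_smul, Real.norm_of_nonneg (hu t ht).1]
  have e1 : ‖Γ (t • y) y ((fderiv ℝ f (t • y) - (Γ (t • y)).flip (f (t • y))) w)‖ ≤
      C * r * (ε * ‖w‖) :=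
    (Γ (t • y) y).le_of_opNorm_le_of_le ((Γ (t • y)).le_of_opNorm_le_of_le (hC _ hm) hyr)
      ((_ : E →L[ℝ] V).le_of_opNorm_le (hε _ hm) w)
  have e2 : ‖Γ (t • y) w ((fderiv ℝ f (t • y) - (Γ (t • y)).flip (f (t • y))) y)‖ ≤
      C * ‖w‖ * (ε * r) :=
    (Γ (t • y) w).le_of_opNorm_le_of_le ((Γ (t • y)).le_of_opNorm_le (hC _ hm) w)
      ((_ : E →L[ℝ] V).le_of_opNorm_le_of_le (hε _ hm) hyr)
  have e3 := (norm_sub_le _ _).trans (add_le_add e1 e2)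
  nlinarith [hu t ht, norm_nonneg
    (Γ (t • y) y ((fderiv ℝ f (t • y) - (Γ (t • y)).flip (f (t • y))) w) -
        Γ (t • y) w ((fderiv ℝ f (t • y) - (Γ (t • y)).flip (f (t • y))) y))]

end
end TotalDifferentialEquations

/-! ### Convergence of the iteration and the linear Frobenius theorem -/

section FlatCoefficients

open Metric MeasureTheory Filter

variable {E V : Type*} [NormedAddCommGroup E] [NormedSpace ℝ E]
  [NormedAddCommGroup V] [NormedSpace ℝ V]
  {Γ : E → E →L[ℝ] V →L[ℝ] V} {f : E → V} {r : ℝ}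

/-- On a ball with `C * r < 1` this makes `radialPicard` a contraction in the sup norm. -/
lemma norm_radialPicard_sub_le {g : E → V} {C η : ℝ} (hΓ : ContinuousOn Γ (ball 0 r))
    (hC : ∀ y ∈ ball (0 : E) r, ‖Γ y‖ ≤ C) (hf : ContinuousOn f (ball 0 r))
    (hg : ContinuousOn g (ball 0 r)) (hη : ∀ y ∈ ball (0 : E) r, ‖f y - g y‖ ≤ η) (v₀ : V) {y : E}
    (hy : y ∈ ball (0 : E) r) : ‖radialPicard Γ v₀ f y - radialPicard Γ v₀ g y‖ ≤ C * r * η := by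
  have c1 := continuousOn_comp_ray hΓ hy
  have c2 := continuousOn_comp_ray hf hy
  have c3 := continuousOn_comp_ray hg hy
  rw [radialPicard, radialPicard, add_sub_add_left_eq_sub, ← intervalIntegral.integral_sub
    ((c1.clm_apply continuousOn_const).clm_apply c2).intervalIntegrable
    ((c1.clm_apply continuousOn_const).clm_apply c3).intervalIntegrable]
  have key := intervalIntegral.norm_integral_le_of_norm_le_const (a := 0) (b := 1)
    (C := C * r * η) (f := fun t : ℝ => Γ (t • y) y (f (t • y)) - Γ (t • y) y (g (t • y))) ?_
  · simpa using key
  intro t ht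
  rw [uIoc_of_le zero_le_one] at ht
  have hm := smul_mem_ball_zero hy ht.1.le ht.2
  rw [← map_sub]
  exact (Γ (t • y) y).le_of_opNorm_le_of_le
    ((Γ (t • y)).le_of_opNorm_le_of_le (hC _ hm) (mem_ball_zero_iff.1 hy).le) (hη _ hm)

lemma norm_radialPicard_sub_const_le {C K : ℝ} (hC : ∀ y ∈ ball (0 : E) r, ‖Γ y‖ ≤ C)
    (hK : ∀ y ∈ ball (0 : E) r, ‖f y‖ ≤ K) (v₀ : V) {y : E} (hy : y ∈ ball (0 : E) r) :
    ‖radialPicard Γ v₀ f y - v₀‖ ≤ C * r * K := by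
  rw [radialPicard, add_sub_cancel_left]
  have key := intervalIntegral.norm_integral_le_of_norm_le_const (a := 0) (b := 1)
    (C := C * r * K) (f := fun t : ℝ => Γ (t • y) y (f (t • y))) ?_
  · simpa using key
  intro t ht
  rw [uIoc_of_le zero_le_one] at ht
  have hm := smul_mem_ball_zero hy ht.1.le ht.2
  exact (Γ (t • y) y).le_of_opNorm_le_of_le
    ((Γ (t • y)).le_of_opNorm_le_of_le (hC _ hm) (mem_ball_zero_iff.1 hy).le) (hK _ hm)

variable [FiniteDimensional ℝ E] [FiniteDimensional ℝ V]

/-- The iterates from the constant `v₀` converge uniformly, and their defects tend uniformly to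
zero. Hence their derivatives converge uniformly to `Γ f`, and the limit may be differentiated term
by term. -/
lemma exists_hasFDerivAt_of_flat_of_bounds {C C' : ℝ} (hr : 0 < r)
    (hΓ : ContDiffOn ℝ 1 Γ (ball 0 r))
    (hC : ∀ y ∈ ball (0 : E) r, ‖Γ y‖ ≤ C) (hC' : ∀ y ∈ ball (0 : E) r, ‖fderiv ℝ Γ y‖ ≤ C')
    (hCr : C * r ≤ 1 / 8)
    (hflat : ∀ y ∈ ball (0 : E) r, ∀ a b v,
      fderiv ℝ Γ y a b v + Γ y b (Γ y a v) = fderiv ℝ Γ y b a v + Γ y a (Γ y b v)) (v₀ : V) :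
    ∃ f : E → V, f 0 = v₀ ∧ ∀ y ∈ ball (0 : E) r, HasFDerivAt f ((Γ y).flip (f y)) y := by
  have c0 : 0 ≤ C := (norm_nonneg _).trans (hC 0 (mem_ball_self hr))
  let F : ℕ → E → V := fun n => (radialPicard Γ v₀)^[n] fun _ => v₀
  have hF0 : F 0 = fun _ => v₀ := rfl
  have hFs : ∀ n, F (n + 1) = radialPicard Γ v₀ (F n) := fun n =>
    Function.iterate_succ_apply' _ _ _
  have flip_le : ∀ y ∈ ball (0 : E) r, ∀ u : V, ‖(Γ y).flip u‖ ≤ C * ‖u‖ := fun y hy u =>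
    (((Γ y).flip).le_opNorm u).trans (by
      rw [ContinuousLinearMap.opNorm_flip]; gcongr; exact hC y hy)
  have hv := norm_nonneg v₀
  -- The last estimate closes because the new defect is at most `2 * (C * r)` times the old one plus
  -- `C` times the last increment. With `C * r ≤ 1 / 8` the first part is at most `C * ‖v₀‖ * (1 /
  -- 2) ^ n`, and so is the second, which gives `4 * C * ‖v₀‖ * (1 / 2) ^ (n + 1)`.
  have main : ∀ n, DifferentiableOn ℝ (F n) (ball 0 r) ∧
      (∀ y ∈ ball (0 : E) r, ‖F n y‖ ≤ 2 * ‖v₀‖) ∧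
      (∀ y ∈ ball (0 : E) r, ‖F (n + 1) y - F n y‖ ≤ ‖v₀‖ * (1 / 4) ^ n) ∧
      (∀ y ∈ ball (0 : E) r,
        ‖fderiv ℝ (F n) y - (Γ y).flip (F n y)‖ ≤ 4 * C * ‖v₀‖ * (1 / 2) ^ n) := by
    intro n
    induction n with
    | zero =>
      refine ⟨differentiableOn_const v₀, fun y _ => by simp only [hF0]; linarith, fun y hy => ?_,
        fun y hy => ?_⟩
      · rw [hFs]
        refine (norm_radialPicard_sub_const_le hC (K := ‖v₀‖) (fun _ _ => le_rfl) v₀ hy).trans ?_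
        rw [pow_zero, mul_one]
        nlinarith
      · simp only [hF0, fderiv_fun_const, Pi.zero_apply, zero_sub, norm_neg, pow_zero, mul_one]
        refine (flip_le y hy v₀).trans ?_
        nlinarith [mul_nonneg c0 hv]
    | succ n ih =>
      obtain ⟨hd, hK, hδ, he⟩ := ih
      have hK' : ∀ y ∈ ball (0 : E) r, ‖fderiv ℝ (F n) y‖ ≤
          4 * C * ‖v₀‖ * (1 / 2) ^ n + C * (2 * ‖v₀‖) := fun y hy => by
        have h1 := he y hy
        have h2 := (flip_le y hy (F n y)).trans (mul_le_mul_of_nonneg_left (hK y hy) c0)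
        have h3 := norm_add_le (fderiv ℝ (F n) y - (Γ y).flip (F n y)) ((Γ y).flip (F n y))
        rw [sub_add_cancel] at h3
        linarith
      have hder := fun y hy => radialPicard_hasFDerivAt hΓ hC hC' hd hK hK' hflat he v₀ (y := y) hy
      rw [← hFs] at hder
      have hd' : DifferentiableOn ℝ (F (n + 1)) (ball 0 r) := fun y hy => by
        obtain ⟨g', hg', -⟩ := hder y hy
        exact hg'.differentiableAt.differentiableWithinAt
      refine ⟨hd', fun y hy => ?_, fun y hy => ?_, fun y hy => ?_⟩
      · have h1 := norm_radialPicard_sub_const_le hC hK v₀ hy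
        rw [← hFs] at h1
        have h2 := norm_add_le (F (n + 1) y - v₀) v₀
        rw [sub_add_cancel] at h2
        nlinarith
      · rw [hFs (n + 1)]
        nth_rewrite 2 [hFs n]
        refine (norm_radialPicard_sub_le hΓ.continuousOn hC hd'.continuousOn hd.continuousOn hδ v₀
          hy).trans ?_
        rw [pow_succ]
        have : 0 ≤ ‖v₀‖ * (1 / 4 : ℝ) ^ n := by positivity
        nlinarith
      · obtain ⟨g', hg', hle⟩ := hder y hy
        rw [hg'.fderiv]
        have h1 := flip_le y hy (F (n + 1) y - F n y)
        have h2 := mul_le_mul_of_nonneg_left (hδ y hy) c0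
        have h3 := norm_sub_le (g' - (Γ y).flip (F n y)) ((Γ y).flip (F (n + 1) y - F n y))
        have h4 : g' - (Γ y).flip (F n y) - (Γ y).flip (F (n + 1) y - F n y) =
            g' - (Γ y).flip (F (n + 1) y) := by
          rw [map_sub]; abel
        rw [h4] at h3
        have h5 : (1 / 4 : ℝ) ^ n ≤ (1 / 2) ^ n := by gcongr; norm_num
        have h6 := mul_le_mul_of_nonneg_left h5 (mul_nonneg c0 hv)
        have h7 : 0 ≤ 4 * C * ‖v₀‖ * (1 / 2 : ℝ) ^ n := by positivity
        have h8 := mul_le_mul_of_nonneg_right hCr h7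
        rw [pow_succ]
        linarith
  have hdist : ∀ y ∈ ball (0 : E) r, ∀ n, dist (F n y) (F (n + 1) y) ≤ ‖v₀‖ * (1 / 4) ^ n :=
    fun y hy n => by rw [dist_comm, dist_eq_norm]; exact (main n).2.2.1 y hy
  have hlim : ∀ y ∈ ball (0 : E) r, ∃ l, Tendsto (fun n => F n y) atTop (𝓝 l) := fun y hy =>
    cauchySeq_tendsto_of_complete
      (cauchySeq_of_le_geometric (1 / 4) ‖v₀‖ (by norm_num) (hdist y hy))
  choose! f hf using hlim
  have hrate : ∀ y ∈ ball (0 : E) r, ∀ n, ‖F n y - f y‖ ≤ ‖v₀‖ * (1 / 4) ^ n / (1 - 1 / 4) :=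
    fun y hy n => by
      rw [← dist_eq_norm]
      exact dist_le_of_le_geometric_of_tendsto (1 / 4) ‖v₀‖ (by norm_num) (hdist y hy) (hf y hy) n
  refine ⟨f, ?_, fun y hy => ?_⟩
  -- At the origin the integrand vanishes, so every iterate has the value `v₀` there.
  · refine tendsto_nhds_unique (hf 0 (mem_ball_self hr)) (tendsto_const_nhds.congr fun n => ?_)
    cases n with
    | zero => rfl
    | succ n => rw [hFs]; simp [radialPicard]
  · refine hasFDerivAt_of_tendstoUniformlyOn isOpen_ball (f := F) (f' := fun n => fderiv ℝ (F n))
      (g' := fun y => (Γ y).flip (f y)) (l := atTop) ?_ (fun n x hx =>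
        ((main n).1.differentiableAt (isOpen_ball.mem_nhds hx)).hasFDerivAt) hf hy
    have hb : ∀ n, ∀ x ∈ ball (0 : E) r, dist ((Γ x).flip (f x)) (fderiv ℝ (F n) x) ≤
        4 * C * ‖v₀‖ * (1 / 2) ^ n + C * (‖v₀‖ * (1 / 4) ^ n / (1 - 1 / 4)) := fun n x hx => by
      rw [dist_comm, dist_eq_norm]
      have h1 := (main n).2.2.2 x hx
      have h2 := (flip_le x hx (F n x - f x)).trans (mul_le_mul_of_nonneg_left (hrate x hx n) c0)
      have h3 := norm_add_le (fderiv ℝ (F n) x - (Γ x).flip (F n x)) ((Γ x).flip (F n x - f x))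
      rw [map_sub, sub_add_sub_cancel] at h3
      rw [map_sub] at h2
      linarith
    have ht : Tendsto (fun n : ℕ => 4 * C * ‖v₀‖ * (1 / 2 : ℝ) ^ n +
        C * (‖v₀‖ * (1 / 4 : ℝ) ^ n / (1 - 1 / 4))) atTop (𝓝 0) := by
      have h2 := tendsto_pow_atTop_nhds_zero_of_lt_one (r := (1 / 2 : ℝ))
        (by norm_num) (by norm_num)
      have h4 := tendsto_pow_atTop_nhds_zero_of_lt_one (r := (1 / 4 : ℝ))
        (by norm_num) (by norm_num)
      simpa using (h2.const_mul (4 * C * ‖v₀‖)).add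
        (((h4.const_mul ‖v₀‖).div_const (1 - 1 / 4 : ℝ)).const_mul C)
    rw [Metric.tendstoUniformlyOn_iff]
    intro ε hε
    filter_upwards [ht.eventually_lt_const hε] with n hn x hx
    exact (hb n x hx).trans_lt hn

/-- **Frobenius theorem** for total differential equations `df y w = Γ y w (f y)` with linear
right-hand side: if the integrability condition holds, they have local solutions with any initial
value. -/
theorem exists_hasFDerivAt_of_flat {s : Set E} (hs : IsOpen s) (hΓ : ContDiffOn ℝ 1 Γ s)
    (hflat : ∀ y ∈ s, ∀ a b v,
      fderiv ℝ Γ y a b v + Γ y b (Γ y a v) = fderiv ℝ Γ y b a v + Γ y a (Γ y b v))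
    {y₀ : E} (hy₀ : y₀ ∈ s) (v₀ : V) :
    ∃ r > 0, ball y₀ r ⊆ s ∧ ∃ f : E → V, f y₀ = v₀ ∧
      ∀ y ∈ ball y₀ r, HasFDerivAt f ((Γ y).flip (f y)) y := by
  have h1 : ∀ᶠ y in 𝓝 y₀, ‖Γ y‖ < ‖Γ y₀‖ + 1 :=
    ((hΓ.continuousOn.continuousAt (hs.mem_nhds hy₀)).norm).eventually_lt_const (by linarith)
  have h2 : ∀ᶠ y in 𝓝 y₀, ‖fderiv ℝ Γ y‖ < ‖fderiv ℝ Γ y₀‖ + 1 :=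
    (((hΓ.continuousOn_fderiv_of_isOpen hs le_rfl).continuousAt
      (hs.mem_nhds hy₀)).norm).eventually_lt_const (by linarith)
  obtain ⟨ρ, hρ, hball⟩ := Metric.eventually_nhds_iff_ball.1 (h1.and (h2.and (hs.mem_nhds hy₀)))
  set C := ‖Γ y₀‖ + 1 with hCdef
  have hC1 : 0 < C := by positivity
  -- The bound `C` holds on the whole ball of radius `ρ`, so shrinking the radius alone achieves `C
  -- * r ≤ 1 / 8`.
  set r := min ρ (1 / (8 * C)) with hrdef
  have hr : 0 < r := by positivity
  have hsub : ∀ y ∈ ball (0 : E) r, y₀ + y ∈ ball y₀ ρ := fun y hy => by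
    rw [mem_ball_iff_norm, add_sub_cancel_left]
    exact (mem_ball_zero_iff.1 hy).trans_le (min_le_left _ _)
  have hfd : ∀ y, fderiv ℝ (fun y => Γ (y₀ + y)) y = fderiv ℝ Γ (y₀ + y) := fun y =>
    fderiv_comp_add_left (f := Γ) y₀
  obtain ⟨f, hf0, hf⟩ := exists_hasFDerivAt_of_flat_of_bounds (Γ := fun y => Γ (y₀ + y)) (r := r)
    (C := C) (C' := ‖fderiv ℝ Γ y₀‖ + 1) hr
    (hΓ.comp (by fun_prop) fun y hy => (hball _ (hsub y hy)).2.2)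
    (fun y hy => (hball _ (hsub y hy)).1.le)
    (fun y hy => by rw [hfd]; exact (hball _ (hsub y hy)).2.1.le)
    (by
      have := mul_le_mul_of_nonneg_left (min_le_right ρ (1 / (8 * C))) hC1.le
      rw [← hrdef] at this
      refine this.trans (le_of_eq ?_)
      field_simp)
    (fun y hy a b v => by rw [hfd]; exact hflat _ (hball _ (hsub y hy)).2.2 a b v) v₀
  refine ⟨r, hr, fun y hy => (hball y (ball_subset_ball (min_le_left _ _) hy)).2.2,
    fun y => f (y - y₀), by simpa using hf0, fun y hy => ?_⟩
  have hy' : y - y₀ ∈ ball (0 : E) r := by rwa [mem_ball_zero_iff, ← mem_ball_iff_norm]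
  have := (hf _ hy').comp y ((hasFDerivAt_id y).sub_const y₀)
  simpa [Function.comp_def] using this

-- Bootstrapping: the equation expresses `df` through `f` itself, so each order of smoothness of `f`
-- yields the next.
omit [FiniteDimensional ℝ E] [FiniteDimensional ℝ V] in
lemma contDiffOn_of_hasFDerivAt_flip {s : Set E} (hs : IsOpen s) (hΓ : ContDiffOn ℝ ∞ Γ s)
    (hf : ∀ y ∈ s, HasFDerivAt f ((Γ y).flip (f y)) y) : ContDiffOn ℝ ∞ f s := by
  rw [contDiffOn_infty]
  intro n
  induction n with
  | zero =>
    exact contDiffOn_zero.2 fun y hy => (hf y hy).continuousAt.continuousWithinAt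
  | succ n ih =>
    push_cast
    rw [contDiffOn_succ_iff_fderiv_of_isOpen hs]
    refine ⟨fun y hy => (hf y hy).differentiableAt.differentiableWithinAt, by simp, ?_⟩
    refine ContDiffOn.congr (f := fun y => (Γ y).flip (f y)) ?_ fun y hy => (hf y hy).fderiv
    exact ((ContinuousLinearMap.flipₗᵢ ℝ E V V).contDiff.comp_contDiffOn
      (hΓ.of_le (by exact_mod_cast le_top))).clm_apply ih

end FlatCoefficients

/-! ### Hessian potentials and affine coordinates on open sets of a vector space -/

section Primitives

open Metric Filter

variable {E F : Type*} [NormedAddCommGroup E] [NormedSpace ℝ E]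
  [NormedAddCommGroup F] [NormedSpace ℝ F] {s : Set E}

lemma contDiffOn_of_hasFDerivAt (hs : IsOpen s) {f : E → F} {f' : E → E →L[ℝ] F}
    (hf : ∀ y ∈ s, HasFDerivAt f (f' y) y) (hf' : ContDiffOn ℝ ∞ f' s) : ContDiffOn ℝ ∞ f s := by
  rw [contDiffOn_infty_iff_fderiv_of_isOpen hs]
  exact ⟨fun y hy => (hf y hy).differentiableAt.differentiableWithinAt,
    hf'.congr fun y hy => (hf y hy).fderiv⟩

/-- A field of symmetric bilinear forms whose derivative is totally symmetric is, on a convex open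
set, the Hessian of a function. -/
lemma exists_hessian_eq (hs : IsOpen s) (hc : Convex ℝ s) {G : E → E →L[ℝ] E →L[ℝ] ℝ}
    (hG : ContDiffOn ℝ ∞ G s) (hsymm : ∀ y ∈ s, ∀ a b, G y a b = G y b a)
    (hG' : ∀ y ∈ s, ∀ a b, fderiv ℝ G y a b = fderiv ℝ G y b a) :
    ∃ h : E → ℝ, ContDiffOn ℝ ∞ h s ∧
      ∀ y ∈ s, ∀ a b, fderiv ℝ (fun z => fderiv ℝ h z a) y b = G y a b := by
  -- The symmetry of the derivative of `G` gives a field of covectors `φ` with `dφ = G`; the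
  -- symmetry of `G` itself then makes `φ` closed, so that `φ = dh`.
  obtain ⟨φ, hφ⟩ := hc.exists_forall_hasFDerivAt_of_fderiv_symmetric hs
    (hG.differentiableOn (by simp)) hG'
  obtain ⟨h, hh⟩ := hc.exists_forall_hasFDerivAt_of_fderiv_symmetric hs
    (fun y hy => (hφ y hy).differentiableAt.differentiableWithinAt)
    (fun y hy a b => by rw [(hφ y hy).fderiv, hsymm y hy])
  refine ⟨h, contDiffOn_of_hasFDerivAt hs hh (contDiffOn_of_hasFDerivAt hs hφ hG),
    fun y hy a b => ?_⟩
  have h1 : (fun z => fderiv ℝ h z a) =ᶠ[𝓝 y] fun z => φ z a :=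
    (hs.eventually_mem hy).mono fun z hz => by simp only [(hh z hz).fderiv]
  rw [h1.fderiv_eq, ((hφ y hy).clm_apply (hasFDerivAt_const a y)).fderiv]
  simp [hsymm y hy a b]

/-- A flat torsion-free connection on an open subset of a vector space, given by its Christoffel
symbols `γ`, has affine coordinates near each point. -/
theorem exists_affineCoordinates [FiniteDimensional ℝ E] {γ : E → E →L[ℝ] E →L[ℝ] E}
    (hs : IsOpen s)
    (hγ : ContDiffOn ℝ ∞ γ s) (hsymm : ∀ y ∈ s, ∀ a b, γ y a b = γ y b a)
    (hflat : ∀ y ∈ s, ∀ a b c, fderiv ℝ γ y a b c + γ y a (γ y b c) =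
      fderiv ℝ γ y b a c + γ y b (γ y a c))
    {y₀ : E} (hy₀ : y₀ ∈ s) :
    ∃ e : OpenPartialHomeomorph E E, y₀ ∈ e.source ∧ e.source ⊆ s ∧
      (∃ r > 0, e.target = ball (e y₀) r) ∧ ContDiffOn ℝ ∞ e e.source ∧
      ContDiffOn ℝ ∞ e.symm e.target ∧
      ∀ y ∈ e.source, ∀ a b, fderiv ℝ (fderiv ℝ e) y a b = fderiv ℝ e y (γ y a b) := by
  -- The unknown is an endomorphism `A` with `dA a = A ∘ γ a`, that is, a coframe of parallel
  -- covectors. Right composition reverses the order of products, which matches the integrability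
  -- condition to `hflat`.
  set L := (ContinuousLinearMap.compL ℝ E E E).flip with hL
  have hLa : ∀ u v w, L u v w = v (u w) := fun u v w => by simp [hL]
  set Γ : E → E →L[ℝ] (E →L[ℝ] E) →L[ℝ] (E →L[ℝ] E) := fun y => L.comp (γ y) with hΓdef
  have hΓ : ContDiffOn ℝ ∞ Γ s := contDiffOn_const.clm_comp hγ
  have hΓ' : ∀ y ∈ s, HasFDerivAt Γ ((ContinuousLinearMap.compL ℝ E _ _ L).comp (fderiv ℝ γ y)) y :=
    fun y hy => (ContinuousLinearMap.compL ℝ E _ _ L).hasFDerivAt.comp y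
      ((hγ.differentiableOn (by simp)).differentiableAt (hs.mem_nhds hy)).hasFDerivAt
  obtain ⟨r, hr, hrs, A, hA0, hA⟩ := exists_hasFDerivAt_of_flat hs (hΓ.of_le (by simp))
    (fun y hy a b v => by
      ext c
      have := congrArg v (hflat y hy a b c)
      simp only [map_add] at this
      rw [(hΓ' y hy).fderiv]
      simpa [hΓdef, hLa] using this) hy₀
    (ContinuousLinearMap.id ℝ E)
  have hAs : ContDiffOn ℝ ∞ A (ball y₀ r) :=
    contDiffOn_of_hasFDerivAt_flip isOpen_ball (hΓ.mono hrs) hA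
  have hA' : ∀ y ∈ ball y₀ r, ∀ a b, fderiv ℝ A y a b = A y (γ y a b) := fun y hy a b => by
    simp [(hA y hy).fderiv, hΓdef, hLa]
  -- Since `dA a b = A (γ a b)` is symmetric in `a` and `b`, the coframe is closed and hence the
  -- differential of a map `k`.
  obtain ⟨k, hk⟩ := (convex_ball y₀ r).exists_forall_hasFDerivAt_of_fderiv_symmetric isOpen_ball
    (hAs.differentiableOn (by simp))
    (fun y hy a b => by rw [hA' y hy, hA' y hy, hsymm y (hrs hy)])
  have hks : ContDiffOn ℝ ∞ k (ball y₀ r) := contDiffOn_of_hasFDerivAt isOpen_ball hk hAs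
  have hm : ball y₀ r ∈ 𝓝 y₀ := ball_mem_nhds y₀ hr
  have hk0 : HasFDerivAt k ((ContinuousLinearEquiv.refl ℝ E : E ≃L[ℝ] E) : E →L[ℝ] E) y₀ := by
    have := hk y₀ (mem_ball_self hr)
    rwa [hA0] at this
  set e₀ := (hks.contDiffAt hm).toOpenPartialHomeomorph k hk0 (by simp) with he₀
  have hcoe : (e₀ : E → E) = k := rfl
  have hmem : y₀ ∈ e₀.source := (hks.contDiffAt hm).mem_toOpenPartialHomeomorph_source hk0 (by simp)
  have hinv : ∀ᶠ y in 𝓝 y₀, y ∈ ball y₀ r ∧ IsUnit (A y) := by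
    refine (eventually_mem_set.2 hm).and ?_
    refine (hAs.continuousOn.continuousAt hm).eventually (p := fun B => IsUnit B) ?_
    rw [hA0]
    exact Units.isOpen.mem_nhds isUnit_one
  obtain ⟨W, hW, hWo, hyW⟩ := _root_.eventually_nhds_iff.1 hinv
  set e₁ := e₀.restrOpen W hWo with he₁
  have hmem1 : y₀ ∈ e₁.source := ⟨hmem, hyW⟩
  -- The image is cut down to a ball because a convex image is needed later for the Hessian
  -- potential.
  obtain ⟨ρ, hρ, hρs⟩ := Metric.isOpen_iff.1 e₁.open_target _ (e₁.map_source hmem1)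
  set e := (e₁.symm.restrOpen (ball (e₁ y₀) ρ) isOpen_ball).symm with he
  have hecoe : (e : E → E) = k := rfl
  have hes : e.source ⊆ e₁.source := by
    intro y hy
    have h1 := e.map_source hy
    have h2 : e y ∈ e₁.target := h1.1
    have h3 := e₁.map_target h2
    have h4 : e₁.symm (e y) = y := e.left_inv hy
    rwa [h4] at h3
  have het : e.target = ball (e₁ y₀) ρ := by
    ext z
    exact ⟨fun h => h.2, fun h => ⟨hρs h, h⟩⟩
  have hyt : e₁ y₀ ∈ e.target := by rw [het]; exact mem_ball_self hρ
  have hye : y₀ ∈ e.source := by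
    have := e.map_target hyt
    have h4 : e.symm (e₁ y₀) = y₀ := e₁.left_inv hmem1
    rwa [h4] at this
  have hsrc : ∀ y ∈ e.source, y ∈ ball y₀ r ∧ IsUnit (A y) := fun y hy => hW y (hes hy).2
  refine ⟨e, hye, fun y hy => hrs (hsrc y hy).1, ⟨ρ, hρ, het⟩,
    hecoe ▸ hks.mono fun y hy => (hsrc y hy).1, fun z hz => ?_, fun y hy a b => ?_⟩
  · have hy := e.map_target hz
    obtain ⟨hyb, u, hu⟩ := hsrc _ hy
    refine (e.contDiffAt_symm (f₀' := ContinuousLinearEquiv.ofUnit u) hz ?_ ?_).contDiffWithinAt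
    · have := hk _ hyb
      rw [← hu] at this
      exact this
    · exact hks.contDiffAt (isOpen_ball.mem_nhds hyb)
  · have h1 : fderiv ℝ k =ᶠ[𝓝 y] A :=
      (isOpen_ball.eventually_mem (hsrc y hy).1).mono fun z hz => (hk z hz).fderiv
    rw [hecoe, h1.fderiv_eq, h1.eq_of_nhds, hA' y (hsrc y hy).1]

end Primitives

/-! ### Derivatives and vector fields in a smooth chart -/

section LocalCoordinates

variable {p q : ℕ} {M : Type*} [TopologicalSpace M] [ChartedSpace (Euc (p + q)) M]
  {E₀ E' : Type*} [NormedAddCommGroup E₀] [NormedSpace ℝ E₀]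
  [NormedAddCommGroup E'] [NormedSpace ℝ E']

/-- The derivative of a vector-valued function on `M` in the direction of a tangent vector. -/
noncomputable def vecDeriv (f : M → E') (x : M) : TangentSpace (𝓡 (p + q)) x →L[ℝ] E' :=
  mfderiv (𝓡 (p + q)) 𝓘(ℝ, E') f x

/-- The coordinate vector `w` of the chart `φ` at the point `z`. -/
noncomputable def coordVec (φ : OpenPartialHomeomorph M E₀) (w : E₀) (z : M) :
    TangentSpace (𝓡 (p + q)) z :=
  (mfderiv 𝓘(ℝ, E₀) (𝓡 (p + q)) φ.symm (φ z) w : Euc (p + q))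

/-- `φ` is a smooth coordinate system on its domain. -/
structure IsSmoothChart (φ : OpenPartialHomeomorph M E₀) : Prop where
  contMDiffOn : ContMDiffOn (𝓡 (p + q)) 𝓘(ℝ, E₀) ∞ φ φ.source
  contMDiffOn_symm : ContMDiffOn 𝓘(ℝ, E₀) (𝓡 (p + q)) ∞ φ.symm φ.target

variable {φ : OpenPartialHomeomorph M E₀} {f g : M → E'} {x z : M}

lemma vecDeriv_congr (h : f =ᶠ[𝓝 x] g) : vecDeriv (p := p) (q := q) f x = vecDeriv g x :=
  h.mfderiv_eq

/-- All tangent spaces are copies of `Euc (p + q)`; typing `u` there allows transport along `φ.symm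
(φ z) = z` without casts. -/
lemma vecDeriv_eq_of_eq {y : M} (h : y = z) (u : Euc (p + q)) :
    vecDeriv (p := p) (q := q) f y u = vecDeriv (p := p) (q := q) f z u := by
  subst h; rfl

lemma IsSmoothChart.mdifferentiableAt (hφ : IsSmoothChart (p := p) (q := q) φ)
    (hz : z ∈ φ.source) : MDifferentiableAt (𝓡 (p + q)) 𝓘(ℝ, E₀) φ z :=
  (hφ.contMDiffOn.contMDiffAt (φ.open_source.mem_nhds hz)).mdifferentiableAt (by simp)

lemma IsSmoothChart.mdifferentiableAt_symm (hφ : IsSmoothChart (p := p) (q := q) φ) {w : E₀}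
    (hw : w ∈ φ.target) : MDifferentiableAt 𝓘(ℝ, E₀) (𝓡 (p + q)) φ.symm w :=
  (hφ.contMDiffOn_symm.contMDiffAt (φ.open_target.mem_nhds hw)).mdifferentiableAt (by simp)

lemma IsSmoothChart.vecDeriv_coordVec (hφ : IsSmoothChart (p := p) (q := q) φ)
    (hz : z ∈ φ.source) (w : E₀) : vecDeriv (p := p) (q := q) φ z (coordVec φ w z) = w := by
  have h1 := hφ.mdifferentiableAt_symm (φ.map_source hz)
  have h2 : MDifferentiableAt (𝓡 (p + q)) 𝓘(ℝ, E₀) φ (φ.symm (φ z)) := by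
    rw [φ.left_inv hz]; exact hφ.mdifferentiableAt hz
  have h3 := mfderiv_comp (φ z) h2 h1
  have h4 : (φ ∘ φ.symm) =ᶠ[𝓝 (φ z)] id :=
    (φ.open_target.eventually_mem (φ.map_source hz)).mono fun w hw => φ.right_inv hw
  rw [h4.mfderiv_eq, mfderiv_id] at h3
  exact (vecDeriv_eq_of_eq (φ.left_inv hz) _).symm.trans (congrArg (fun L => L w) h3).symm

lemma IsSmoothChart.coordVec_vecDeriv (hφ : IsSmoothChart (p := p) (q := q) φ)
    (hz : z ∈ φ.source) (v : TangentSpace (𝓡 (p + q)) z) :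
    coordVec φ (vecDeriv (p := p) (q := q) φ z v) z = v := by
  have h1 := hφ.mdifferentiableAt_symm (φ.map_source hz)
  have h3 := mfderiv_comp z h1 (hφ.mdifferentiableAt hz)
  have h4 : (φ.symm ∘ φ) =ᶠ[𝓝 z] id :=
    (φ.open_source.eventually_mem hz).mono fun w hw => φ.left_inv hw
  rw [h4.mfderiv_eq, mfderiv_id] at h3
  exact (congrArg (fun L => L v) h3).symm

lemma coordVec_add (w w' : E₀) (z : M) :
    coordVec (p := p) (q := q) φ (w + w') z = coordVec φ w z + coordVec φ w' z :=
  map_add (mfderiv 𝓘(ℝ, E₀) (𝓡 (p + q)) φ.symm (φ z)) w w'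

lemma coordVec_smul (c : ℝ) (w : E₀) (z : M) :
    coordVec (p := p) (q := q) φ (c • w) z = c • coordVec φ w z :=
  map_smul (mfderiv 𝓘(ℝ, E₀) (𝓡 (p + q)) φ.symm (φ z)) c w

/-- Derivatives in the direction of coordinate vectors are derivatives in the chart. -/
lemma IsSmoothChart.vecDeriv_apply_coordVec (hφ : IsSmoothChart (p := p) (q := q) φ)
    (hz : z ∈ φ.source) (hf : MDifferentiableAt (𝓡 (p + q)) 𝓘(ℝ, E') f z) (w : E₀) :
    vecDeriv (p := p) (q := q) f z (coordVec φ w z) = fderiv ℝ (f ∘ φ.symm) (φ z) w := by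
  have h1 := hφ.mdifferentiableAt_symm (φ.map_source hz)
  have h2 : MDifferentiableAt (𝓡 (p + q)) 𝓘(ℝ, E') f (φ.symm (φ z)) := by
    rwa [φ.left_inv hz]
  have h3 := mfderiv_comp (φ z) h2 h1
  rw [mfderiv_eq_fderiv] at h3
  exact (vecDeriv_eq_of_eq (φ.left_inv hz) _).symm.trans (congrArg (fun L => L w) h3).symm

lemma vecDeriv_clm_comp {E'' : Type*} [NormedAddCommGroup E''] [NormedSpace ℝ E'']
    (L : E' →L[ℝ] E'') (hf : MDifferentiableAt (𝓡 (p + q)) 𝓘(ℝ, E') f z)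
    (v : TangentSpace (𝓡 (p + q)) z) :
    vecDeriv (p := p) (q := q) (fun y => L (f y)) z v = L (vecDeriv f z v) := by
  have h := mfderiv_comp z (g := L) (f := f) L.differentiableAt.mdifferentiableAt hf
  rw [mfderiv_eq_fderiv, L.fderiv] at h
  exact congrArg (fun L => L v) h

/-- A function with zero derivative is locally constant. -/
lemma IsSmoothChart.eventually_eq_of_vecDeriv_eq_zero (hφ : IsSmoothChart (p := p) (q := q) φ)
    (hx : x ∈ φ.source)
    (hf : ∀ᶠ z in 𝓝 x, MDifferentiableAt (𝓡 (p + q)) 𝓘(ℝ, E') f z ∧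
      ∀ v, vecDeriv (p := p) (q := q) f z v = 0) : ∀ᶠ z in 𝓝 x, f z = f x := by
  have h1 : ∀ᶠ w in 𝓝 (φ x), w ∈ φ.target ∧ (MDifferentiableAt (𝓡 (p + q)) 𝓘(ℝ, E') f (φ.symm w) ∧
      ∀ v, vecDeriv (p := p) (q := q) f (φ.symm w) v = 0) :=
    (φ.open_target.eventually_mem (φ.map_source hx)).and
      ((φ.continuousAt_symm (φ.map_source hx)).eventually (by rwa [φ.left_inv hx]))
  obtain ⟨r, hr, hball⟩ := Metric.eventually_nhds_iff_ball.1 h1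
  have h2 : ∀ w ∈ Metric.ball (φ x) r, HasFDerivAt (f ∘ φ.symm) (0 : E₀ →L[ℝ] E') w := by
    intro w hw
    obtain ⟨ht, hd, h0⟩ := hball w hw
    have hs := hφ.mdifferentiableAt_symm ht
    have h3 := hd.comp w hs
    rw [mdifferentiableAt_iff_differentiableAt] at h3
    convert h3.hasFDerivAt
    ext u
    have h4 := hφ.vecDeriv_apply_coordVec (φ.map_target ht) hd u
    rw [h0, φ.right_inv ht] at h4
    simpa using h4
  have h5 : ∀ᶠ z in 𝓝 x, z ∈ φ.source ∧ φ z ∈ Metric.ball (φ x) r :=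
    (φ.open_source.eventually_mem hx).and
      ((φ.continuousAt hx).eventually (Metric.ball_mem_nhds _ hr))
  filter_upwards [h5] with z hz
  have h6 := (convex_ball (φ x) r).is_const_of_fderivWithin_eq_zero (𝕜 := ℝ)
    (fun w hw => (h2 w hw).differentiableAt.differentiableWithinAt)
    (fun w hw => by
      rw [fderivWithin_of_isOpen Metric.isOpen_ball hw, (h2 w hw).fderiv])
    hz.2 (Metric.mem_ball_self hr)
  simpa [φ.left_inv hz.1, φ.left_inv hx] using h6

variable [IsManifold (𝓡 (p + q)) ∞ M]

lemma IsSmoothField.mono {U V : Set M} {X : ∀ x : M, TangentSpace (𝓡 (p + q)) x}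
    (hX : IsSmoothField U X) (h : V ⊆ U) : IsSmoothField V X := ContMDiffOn.mono hX h

/-- The derivative is the fibre component of the tangent map of `f` composed with the section `X`.
-/
lemma IsSmoothField.contMDiffOn_vecDeriv {U : Set M} (hU : IsOpen U)
    {X : ∀ x : M, TangentSpace (𝓡 (p + q)) x} (hX : IsSmoothField U X)
    (hf : ContMDiffOn (𝓡 (p + q)) 𝓘(ℝ, E') ∞ f U) :
    ContMDiffOn (𝓡 (p + q)) 𝓘(ℝ, E') ∞ (fun z => vecDeriv (p := p) (q := q) f z (X z)) U := by
  have h1 := (hf.contMDiffOn_tangentMapWithin (m := ∞) le_rfl hU.uniqueMDiffOn).comp hX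
    (fun z hz => hz)
  have h2 := (contMDiff_snd_tangentBundle_modelSpace E' 𝓘(ℝ, E')).comp_contMDiffOn h1
  refine h2.congr fun z hz => ?_
  have h3 : vecDeriv (p := p) (q := q) f z (X z) =
      mfderivWithin (𝓡 (p + q)) 𝓘(ℝ, E') f U z (X z) := by
    rw [mfderivWithin_of_isOpen hU hz]; rfl
  exact h3

/-- The field is the tangent map of `φ.symm` composed with `z ↦ (φ z, w z)`. Variable components `w`
are allowed, as sections with nonconstant components and the leafwise projection require. -/
lemma IsSmoothChart.isSmoothField_coordVec (hφ : IsSmoothChart (p := p) (q := q) φ) {U : Set M}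
    (hU : U ⊆ φ.source) {w : M → E₀} (hw : ContMDiffOn (𝓡 (p + q)) 𝓘(ℝ, E₀) ∞ w U) :
    IsSmoothField (p := p) (q := q) U (fun z => coordVec φ (w z) z) := by
  have h1 := hφ.contMDiffOn_symm.contMDiffOn_tangentMapWithin (m := ∞) le_rfl
    φ.open_target.uniqueMDiffOn
  have h2 : ContMDiffOn (𝓡 (p + q)) 𝓘(ℝ, E₀).tangent ∞
      (fun z => (⟨φ z, w z⟩ : TangentBundle 𝓘(ℝ, E₀) E₀)) U := by
    intro z hz
    rw [Bundle.contMDiffWithinAt_totalSpace]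
    refine ⟨(hφ.contMDiffOn.mono hU) z hz, ?_⟩
    simpa using hw z hz
  have h3 := h1.comp h2 (fun z hz => φ.map_source (hU hz))
  refine h3.congr fun z hz => ?_
  simp only [Function.comp_apply, tangentMapWithin]
  rw [mfderivWithin_of_isOpen φ.open_target (φ.map_source (hU hz))]
  ext
  · exact (φ.left_inv (hU hz)).symm
  · exact HEq.rfl

end LocalCoordinates

/-! ### The Lie bracket as a commutator of derivations -/

section Brackets

variable {p q : ℕ} {M : Type*} [TopologicalSpace M] [ChartedSpace (Euc (p + q)) M]
  [IsManifold (𝓡 (p + q)) ∞ M]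
  {E₀ E' : Type*} [NormedAddCommGroup E₀] [NormedSpace ℝ E₀] [CompleteSpace E₀]
  [NormedAddCommGroup E'] [NormedSpace ℝ E']
  {φ : OpenPartialHomeomorph M E₀} {f : M → E'} {x : M}
  {X Y : ∀ x : M, TangentSpace (𝓡 (p + q)) x}

/-- The Lie bracket acts on functions as the commutator. -/
lemma IsSmoothChart.vecDeriv_mlieBracket (hφ : IsSmoothChart (p := p) (q := q) φ)
    (hx : x ∈ φ.source) {U : Set M} (hU : IsOpen U) (hxU : x ∈ U) (hX : IsSmoothField U X)
    (hY : IsSmoothField U Y) (hf : ContMDiffOn (𝓡 (p + q)) 𝓘(ℝ, E') ∞ f U) :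
    vecDeriv (p := p) (q := q) f x (VectorField.mlieBracket (𝓡 (p + q)) X Y x) =
      vecDeriv (fun z => vecDeriv f z (Y z)) x (X x) -
        vecDeriv (fun z => vecDeriv f z (X z)) x (Y x) := by
  obtain ⟨w, hw, rfl⟩ : ∃ w ∈ φ.target, φ.symm w = x := ⟨φ x, φ.map_source hx, φ.left_inv hx⟩
  -- Both fields are pulled back to the chart: brackets commute with pullback, and in a vector space
  -- the commutator formula is symmetry of the second derivative.
  set X' := VectorField.mpullback 𝓘(ℝ, E₀) (𝓡 (p + q)) φ.symm X with hX'
  set Y' := VectorField.mpullback 𝓘(ℝ, E₀) (𝓡 (p + q)) φ.symm Y with hY'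
  have hUm := hU.mem_nhds hxU
  have hinv : ∀ w ∈ φ.target, (mfderiv 𝓘(ℝ, E₀) (𝓡 (p + q)) φ.symm w).IsInvertible := by
    intro w hw
    have h1 := hφ.coordVec_vecDeriv (φ.map_target hw)
    have h2 := hφ.vecDeriv_coordVec (φ.map_target hw)
    have h3 : ∀ y, y = w → ∀ u, (mfderiv 𝓘(ℝ, E₀) (𝓡 (p + q)) φ.symm y u : Euc (p + q)) =
        mfderiv 𝓘(ℝ, E₀) (𝓡 (p + q)) φ.symm w u := fun y hy u => by subst hy; rfl
    exact ⟨ContinuousLinearEquiv.equivOfInverse (mfderiv 𝓘(ℝ, E₀) (𝓡 (p + q)) φ.symm w)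
      (vecDeriv φ (φ.symm w))
      (fun u => (congrArg (vecDeriv φ (φ.symm w)) (h3 _ (φ.right_inv hw) u)).symm.trans (h2 u))
      (fun v => (h3 _ (φ.right_inv hw) _).symm.trans (h1 v)), rfl⟩
  have hsm : ∀ w ∈ φ.target, ContMDiffAt 𝓘(ℝ, E₀) (𝓡 (p + q)) ∞ φ.symm w := fun w hw =>
    hφ.contMDiffOn_symm.contMDiffAt (φ.open_target.mem_nhds hw)
  have hd : ∀ {Z : ∀ x : M, TangentSpace (𝓡 (p + q)) x}, IsSmoothField U Z →
      DifferentiableAt ℝ (VectorField.mpullback 𝓘(ℝ, E₀) (𝓡 (p + q)) φ.symm Z) w := by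
    intro Z hZ
    have h1 := MDifferentiableAt.mpullback_vectorField
      ((ContMDiffOn.contMDiffAt hZ hUm).mdifferentiableAt (by simp)) (hsm w hw) (hinv w hw)
      (by norm_cast)
    have h2 := (contMDiff_snd_tangentBundle_modelSpace (n := 1) E₀ 𝓘(ℝ, E₀)).mdifferentiable
      one_ne_zero
    exact ((h2 _).comp w h1).differentiableAt
  have : IsManifold (𝓡 (p + q)) (minSmoothness ℝ 2) M :=
    IsManifold.of_le (n := ∞) (by simp; norm_cast)
  have hbr := VectorField.mpullback_mlieBracket (n := ∞) (I := 𝓘(ℝ, E₀)) (I' := 𝓡 (p + q))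
    ((ContMDiffOn.contMDiffAt hX hUm).mdifferentiableAt (by simp))
    ((ContMDiffOn.contMDiffAt hY hUm).mdifferentiableAt (by simp)) (hsm w hw) (by simp; norm_cast)
  have hflat : VectorField.mlieBracket 𝓘(ℝ, E₀) X' Y' = VectorField.lieBracket ℝ X' Y' := by
    rw [← VectorField.mlieBracketWithin_univ, VectorField.mlieBracketWithin_eq_lieBracketWithin]
    exact VectorField.lieBracketWithin_univ
  rw [← hX', ← hY', hflat] at hbr
  have hpush : ∀ w ∈ φ.target, ∀ Z : ∀ x : M, TangentSpace (𝓡 (p + q)) x,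
      mfderiv 𝓘(ℝ, E₀) (𝓡 (p + q)) φ.symm w
        (VectorField.mpullback 𝓘(ℝ, E₀) (𝓡 (p + q)) φ.symm Z w) = Z (φ.symm w) := fun w hw Z =>
    (hinv w hw).self_apply_inverse _
  have hchain : ∀ {E'' : Type _} [NormedAddCommGroup E''] [NormedSpace ℝ E''] {u : M → E''}
      {w : E₀}, w ∈ φ.target → MDifferentiableAt (𝓡 (p + q)) 𝓘(ℝ, E'') u (φ.symm w) →
      ∀ Z : ∀ x : M, TangentSpace (𝓡 (p + q)) x,
      fderiv ℝ (u ∘ φ.symm) w (VectorField.mpullback 𝓘(ℝ, E₀) (𝓡 (p + q)) φ.symm Z w) =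
        vecDeriv u (φ.symm w) (Z (φ.symm w)) := by
    intro E'' _ _ u w hw hu Z
    have h3 := mfderiv_comp w hu (hφ.mdifferentiableAt_symm hw)
    rw [mfderiv_eq_fderiv] at h3
    have h4 := congrArg (fun L => L (VectorField.mpullback 𝓘(ℝ, E₀) (𝓡 (p + q)) φ.symm Z w)) h3
    refine h4.trans ?_
    exact congrArg (mfderiv (𝓡 (p + q)) 𝓘(ℝ, E'') u (φ.symm w)) (hpush w hw Z)
  have hfd : ∀ z ∈ U, MDifferentiableAt (𝓡 (p + q)) 𝓘(ℝ, E') f z := fun z hz =>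
    (hf.contMDiffAt (hU.mem_nhds hz)).mdifferentiableAt (by simp)
  have hfs : ContDiffAt ℝ ∞ (f ∘ φ.symm) w :=
    ((hf.contMDiffAt hUm).comp w (hsm w hw)).contDiffAt
  have key := VectorField.fderiv_apply_lieBracket (V := X') (W := Y') hfs (by simp; norm_cast)
    (hd hY) (hd hX)
  have hnear : ∀ᶠ w' in 𝓝 w, w' ∈ φ.target ∧ φ.symm w' ∈ U :=
    (φ.open_target.eventually_mem hw).and ((φ.continuousAt_symm hw).eventually hUm)
  have hE : ∀ Z : ∀ x : M, TangentSpace (𝓡 (p + q)) x,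
      (fun w => fderiv ℝ (f ∘ φ.symm) w
        (VectorField.mpullback 𝓘(ℝ, E₀) (𝓡 (p + q)) φ.symm Z w)) =ᶠ[𝓝 w]
      (fun z => vecDeriv f z (Z z)) ∘ φ.symm := fun Z =>
    hnear.mono fun w' hw' => hchain hw'.1 (hfd _ hw'.2) Z
  have hm : ∀ {Z : ∀ x : M, TangentSpace (𝓡 (p + q)) x}, IsSmoothField U Z →
      MDifferentiableAt (𝓡 (p + q)) 𝓘(ℝ, E') (fun z => vecDeriv (p := p) (q := q) f z (Z z))
        (φ.symm w) := fun {Z} hZ =>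
    ((hZ.contMDiffOn_vecDeriv hU hf).contMDiffAt hUm).mdifferentiableAt (by simp)
  rw [(hE X).fderiv_eq, (hE Y).fderiv_eq, hchain hw (hm hY), hchain hw (hm hX), ← hbr,
    hchain hw (hfd _ hxU)] at key
  exact key

end Brackets

/-! ### Adapted charts and the frame `∂̄/∂yᵃ` of the normal bundle -/

section AdaptedCharts

variable {p q : ℕ} {M : Type*} [TopologicalSpace M] [ChartedSpace (Euc (p + q)) M]
  [IsManifold (𝓡 (p + q)) ∞ M] {F : Foliation p q M}
  {E' : Type*} [NormedAddCommGroup E'] [NormedSpace ℝ E']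
  {φ ψ : OpenPartialHomeomorph M (Euc p × Euc q)} {x z : M} {U : Set M}

omit [IsManifold (𝓡 (p + q)) ∞ M] in
lemma vecDeriv_of_eventually_const {f : M → E'} {c : E'} (h : ∀ᶠ z in 𝓝 x, f z = c)
    (v : TangentSpace (𝓡 (p + q)) x) : vecDeriv f x v = 0 := by
  have h' : f =ᶠ[𝓝 x] fun _ => c := h
  rw [vecDeriv_congr h']
  exact congrArg (fun L => L v) (mfderiv_const (I := 𝓡 (p + q)) (I' := 𝓘(ℝ, E')) (c := c))

/-- The transverse coordinates `dy(v)` of the tangent vector `v`. -/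
noncomputable def transv (φ : OpenPartialHomeomorph M (Euc p × Euc q)) (z : M) :
    TangentSpace (𝓡 (p + q)) z →L[ℝ] Euc q :=
  vecDeriv (fun z => (φ z).2) z

namespace Foliation

lemma coord_add (φ : OpenPartialHomeomorph M (Euc p × Euc q)) (a b : Euc q) (z : M) :
    F.coord φ (a + b) z = F.coord φ a z + F.coord φ b z := by
  have h := coordVec_add (p := p) (q := q) (φ := φ) (0, a) (0, b) z
  rw [Prod.mk_add_mk, add_zero] at h
  exact (congrArg (F.tangent z).mkQ h).trans (map_add _ _ _)

lemma coord_smul (φ : OpenPartialHomeomorph M (Euc p × Euc q)) (r : ℝ) (a : Euc q) (z : M) :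
    F.coord φ (r • a) z = r • F.coord φ a z := by
  have h := coordVec_smul (p := p) (q := q) (φ := φ) r (0, a) z
  rw [Prod.smul_mk, smul_zero] at h
  exact (congrArg (F.tangent z).mkQ h).trans (map_smul _ _ _)

/-- The coordinates `c ↦ ∑ cᵃ ∂̄/∂yᵃ` of the normal space, as a linear map. -/
noncomputable def coordₗ (F : Foliation p q M) (φ : OpenPartialHomeomorph M (Euc p × Euc q))
    (z : M) : Euc q →ₗ[ℝ] F.Normal z where
  toFun c := F.coord φ c z
  map_add' a b := coord_add φ a b z
  map_smul' r a := coord_smul φ r a z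

lemma coordₗ_apply (φ : OpenPartialHomeomorph M (Euc p × Euc q)) (z : M) (c : Euc q) :
    F.coordₗ φ z c = F.coord φ c z := rfl

lemma bar_coordVec (φ : OpenPartialHomeomorph M (Euc p × Euc q)) (c : Euc q) :
    F.bar (coordVec φ ((0, c) : Euc p × Euc q)) = F.coord φ c := rfl

end Foliation

namespace IsAdaptedChart

variable (hφ : IsAdaptedChart F.tangent φ)

include hφ

lemma isSmoothChart : IsSmoothChart (p := p) (q := q) φ := ⟨hφ.contMDiffOn, hφ.contMDiffOn_symm⟩

lemma contMDiffOn_snd :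
    ContMDiffOn (𝓡 (p + q)) 𝓘(ℝ, Euc q) ∞ (fun z => (φ z).2) φ.source :=
  (ContinuousLinearMap.snd ℝ (Euc p) (Euc q)).contMDiff.comp_contMDiffOn hφ.contMDiffOn

lemma transv_eq (hz : z ∈ φ.source) (v : TangentSpace (𝓡 (p + q)) z) :
    transv φ z v = (vecDeriv φ z v).2 :=
  vecDeriv_clm_comp (ContinuousLinearMap.snd ℝ (Euc p) (Euc q))
    (hφ.isSmoothChart.mdifferentiableAt hz) v

lemma transv_coordVec (hz : z ∈ φ.source) (w : Euc p × Euc q) :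
    transv φ z (coordVec φ w z) = w.2 := by
  rw [hφ.transv_eq hz, hφ.isSmoothChart.vecDeriv_coordVec hz]

lemma mem_tangent_iff (hz : z ∈ φ.source) (v : TangentSpace (𝓡 (p + q)) z) :
    v ∈ F.tangent z ↔ transv φ z v = 0 := hφ.mem_iff z hz v

/-- The leaf directions are the kernel of `dy`, so `dy` descends to the normal space and is inverse
there to `F.coord φ`. Identities between sections are thus checked on transverse components. -/
lemma mkQ_eq_mkQ_iff (hz : z ∈ φ.source) (v w : TangentSpace (𝓡 (p + q)) z) :
    (F.tangent z).mkQ v = (F.tangent z).mkQ w ↔ transv φ z v = transv φ z w := by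
  rw [Submodule.mkQ_apply, Submodule.mkQ_apply, Submodule.Quotient.eq, hφ.mem_tangent_iff hz,
    map_sub, sub_eq_zero]

lemma mkQ_eq_coord (hz : z ∈ φ.source) (v : TangentSpace (𝓡 (p + q)) z) :
    (F.tangent z).mkQ v = F.coord φ (transv φ z v) z :=
  (hφ.mkQ_eq_mkQ_iff hz v (coordVec φ ((0, transv φ z v) : Euc p × Euc q) z)).2
    (hφ.transv_coordVec hz (0, transv φ z v)).symm

lemma coord_injective (hz : z ∈ φ.source) {a b : Euc q} (h : F.coord φ a z = F.coord φ b z) :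
    a = b := by
  have h1 := (hφ.mkQ_eq_mkQ_iff hz (coordVec φ ((0, a) : Euc p × Euc q) z)
    (coordVec φ ((0, b) : Euc p × Euc q) z)).1 h
  rwa [hφ.transv_coordVec hz, hφ.transv_coordVec hz] at h1

lemma coord_eq_zero (hz : z ∈ φ.source) {a : Euc q} (h : F.coord φ a z = 0) : a = 0 :=
  hφ.coord_injective hz (h.trans (map_zero (F.coordₗ φ z)).symm)

lemma coordVec_left_mem (hz : z ∈ φ.source) (u : Euc p) :
    coordVec φ ((u, 0) : Euc p × Euc q) z ∈ F.tangent z :=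
  (hφ.mem_tangent_iff hz _).2 (hφ.transv_coordVec hz _)

lemma isSmoothSection_coord (hU : IsOpen U) (hUφ : U ⊆ φ.source) {σ : M → Euc q}
    (hσ : ContMDiffOn (𝓡 (p + q)) 𝓘(ℝ, Euc q) ∞ σ U) :
    F.IsSmoothSection U (fun z => F.coord φ (σ z) z) := fun _ hx =>
  ⟨U, hU, hx, subset_rfl, fun z => coordVec φ ((0, σ z) : Euc p × Euc q) z,
    hφ.isSmoothChart.isSmoothField_coordVec hUφ
      ((ContinuousLinearMap.inr ℝ (Euc p) (Euc q)).contMDiff.comp_contMDiffOn hσ),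
    fun _ _ => rfl⟩

lemma contMDiffOn_transv (hU : IsOpen U) (hUφ : U ⊆ φ.source)
    {X : ∀ x : M, TangentSpace (𝓡 (p + q)) x} (hX : IsSmoothField U X) :
    ContMDiffOn (𝓡 (p + q)) 𝓘(ℝ, Euc q) ∞ (fun z => transv φ z (X z)) U :=
  hX.contMDiffOn_vecDeriv hU (hφ.contMDiffOn_snd.mono hUφ)

/-- A smooth section of the normal bundle has smooth components. -/
lemma exists_eq_coord (hUφ : U ⊆ φ.source) {s : ∀ x : M, F.Normal x}
    (hs : F.IsSmoothSection U s) :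
    ∃ σ : M → Euc q, ContMDiffOn (𝓡 (p + q)) 𝓘(ℝ, Euc q) ∞ σ U ∧
      ∀ z ∈ U, s z = F.coord φ (σ z) z := by
  have hex : ∀ z, ∃ c : Euc q, z ∈ φ.source → s z = F.coord φ c z := fun z => by
    obtain ⟨v, hv⟩ := (F.tangent z).mkQ_surjective (s z)
    exact ⟨transv φ z v, fun hz => by rw [← hφ.mkQ_eq_coord hz, hv]⟩
  choose σ hσ using hex
  refine ⟨σ, fun x hx => ?_, fun z hz => hσ z (hUφ hz)⟩
  obtain ⟨V, hV, hxV, hVU, Y, hY, hsY⟩ := hs x hx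
  have h1 := hφ.contMDiffOn_transv hV (hVU.trans hUφ) hY
  have h2 : ContMDiffOn (𝓡 (p + q)) 𝓘(ℝ, Euc q) ∞ σ V := h1.congr fun z hz => by
    have hzs := hUφ (hVU hz)
    refine hφ.coord_injective hzs ?_
    rw [← hσ z hzs, hsY z hz]
    exact hφ.mkQ_eq_coord hzs (Y z)
  exact (h2.contMDiffAt (hV.mem_nhds hxV)).contMDiffWithinAt

lemma isFoliatedSection_coord (c : Euc q) : F.IsFoliatedSection φ.source (F.coord φ c) :=
  fun _ hx => ⟨φ, hx, subset_rfl, hφ, fun _ => c, contDiffOn_const, fun _ _ => rfl⟩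

/-- The commutator formula applied to the vector-valued function `y`. -/
lemma transv_mlieBracket (hU : IsOpen U) (hUφ : U ⊆ φ.source) (hx : x ∈ U)
    {X Y : ∀ x : M, TangentSpace (𝓡 (p + q)) x} (hX : IsSmoothField U X)
    (hY : IsSmoothField U Y) :
    transv φ x (VectorField.mlieBracket (𝓡 (p + q)) X Y x) =
      vecDeriv (fun z => transv φ z (Y z)) x (X x) -
        vecDeriv (fun z => transv φ z (X z)) x (Y x) :=
  hφ.isSmoothChart.vecDeriv_mlieBracket (hUφ hx) hU hx hX hY (hφ.contMDiffOn_snd.mono hUφ)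

lemma isSmoothField_coordVec (w : Euc p × Euc q) :
    IsSmoothField (p := p) (q := q) φ.source (coordVec φ w) :=
  hφ.isSmoothChart.isSmoothField_coordVec subset_rfl contMDiffOn_const

lemma vecDeriv_transv_coordVec (hx : x ∈ φ.source) (w : Euc p × Euc q)
    (v : TangentSpace (𝓡 (p + q)) x) :
    vecDeriv (fun z => transv φ z (coordVec φ w z)) x v = 0 :=
  vecDeriv_of_eventually_const
    ((φ.open_source.eventually_mem hx).mono fun _ hz => hφ.transv_coordVec hz w) v

/-- Coordinate vector fields of adapted charts are infinitesimal automorphisms. -/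
lemma isInfinitesimalAut_coordVec (w : Euc p × Euc q) :
    F.IsInfinitesimalAut φ.source (coordVec φ w) := by
  refine ⟨hφ.isSmoothField_coordVec w, fun V hV hVφ W hW hWT x hx => ?_⟩
  -- Both terms of `dy([∂_w, W])` vanish: `dy(W)` is zero and `dy(∂_w)` is constant.
  rw [hφ.mem_tangent_iff (hVφ hx),
    hφ.transv_mlieBracket hV hVφ hx ((hφ.isSmoothField_coordVec w).mono hVφ) hW,
    hφ.vecDeriv_transv_coordVec (hVφ hx), vecDeriv_of_eventually_const (c := 0), sub_zero]
  exact (hV.eventually_mem hx).mono fun z hz => (hφ.mem_tangent_iff (hVφ hz) _).1 (hWT z hz)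

/-- Tangency of the bracket is all that is needed: torsion sees its class in the normal bundle, and
`D` in leaf directions kills coordinate sections. -/
lemma mlieBracket_coordVec_mem (hx : x ∈ φ.source) (w w' : Euc p × Euc q) :
    VectorField.mlieBracket (𝓡 (p + q)) (coordVec φ w) (coordVec φ w') x ∈ F.tangent x := by
  rw [hφ.mem_tangent_iff hx, hφ.transv_mlieBracket φ.open_source subset_rfl hx
    (hφ.isSmoothField_coordVec w) (hφ.isSmoothField_coordVec w'),
    hφ.vecDeriv_transv_coordVec hx, hφ.vecDeriv_transv_coordVec hx, sub_zero]

end IsAdaptedChart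

end AdaptedCharts

/-! ### Connections in the normal bundle: locality, components, flatness -/

section Connections

variable {p q : ℕ} {M : Type*} [TopologicalSpace M] [T2Space M] [ChartedSpace (Euc (p + q)) M]
  [IsManifold (𝓡 (p + q)) ∞ M] {F : Foliation p q M}
  {φ ψ : OpenPartialHomeomorph M (Euc p × Euc q)} {x z : M} {U : Set M}

namespace Foliation.IsSmoothSection

variable {s t : ∀ x : M, F.Normal x}

lemma mono {V : Set M} (hV : IsOpen V) (hVU : V ⊆ U) (hs : F.IsSmoothSection U s) :
    F.IsSmoothSection V s := fun x hx => by
  obtain ⟨W, hW, hxW, -, Y, hY, hsY⟩ := hs x (hVU hx)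
  exact ⟨W ∩ V, hW.inter hV, ⟨hxW, hx⟩, inter_subset_right, Y, hY.mono inter_subset_left,
    fun z hz => hsY z hz.1⟩

lemma congr (hs : F.IsSmoothSection U s) (h : ∀ z ∈ U, t z = s z) : F.IsSmoothSection U t :=
  fun x hx => by
    obtain ⟨W, hW, hxW, hWU, Y, hY, hsY⟩ := hs x hx
    exact ⟨W, hW, hxW, hWU, Y, hY, fun z hz => (h z (hWU hz)).trans (hsY z hz)⟩

end Foliation.IsSmoothSection

namespace NormalConnection

variable (D : NormalConnection F) {s t : ∀ x : M, F.Normal x}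

/-- A connection in the normal bundle is local. -/
lemma toFun_congr (hU : IsOpen U) (hx : x ∈ U) (hs : F.IsSmoothSection U s)
    (h : ∀ z ∈ U, s z = t z) (v : TangentSpace (𝓡 (p + q)) x) :
    D.toFun s x v = D.toFun t x v := by
  -- A bump function `f` equal to `1` near `x` and supported in `U` makes `f • s` and `f • t` equal
  -- on all of `M`; since `df = 0` at `x`, the Leibniz rule removes `f` again.
  obtain ⟨f, -, hf⟩ := (SmoothBumpFunction.nhds_basis_support (I := 𝓡 (p + q))
    (hU.mem_nhds hx)).mem_iff.1 (hU.mem_nhds hx)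
  have hfs : ContMDiffOn (𝓡 (p + q)) 𝓘(ℝ, ℝ) ∞ f U := f.contMDiff.contMDiffOn
  have hd : dirDeriv f x v = 0 := vecDeriv_of_eventually_const f.eventuallyEq_one v
  have h1 := D.leibniz U hU f s hfs hs x hx v
  have h2 := D.leibniz U hU f t hfs (hs.congr fun z hz => (h z hz).symm) x hx v
  have h3 : (fun z => f z • s z) = fun z => f z • t z := by
    funext z
    by_cases hz : z ∈ U
    · rw [h z hz]
    · have : f z = 0 := by
        by_contra h0
        exact hz (hf h0)
      rw [this, zero_smul, zero_smul]
  rw [h3, h2] at h1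
  simpa [hd, f.eq_one] using h1.symm

lemma toFun_zero (x : M) (v : TangentSpace (𝓡 (p + q)) x) :
    D.toFun (fun z => (0 : F.Normal z)) x v = 0 := by
  have hs : F.IsSmoothSection univ (fun z => (0 : F.Normal z)) := fun x _ =>
    ⟨univ, isOpen_univ, mem_univ _, subset_rfl, fun _ => 0,
      (Bundle.contMDiff_zeroSection ℝ _).contMDiffOn, fun z _ => (map_zero _).symm⟩
  have h := D.leibniz univ isOpen_univ (fun _ => 0) _ contMDiffOn_const hs x (mem_univ x) v
  have hd : dirDeriv (fun _ : M => (0 : ℝ)) x v = 0 :=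
    vecDeriv_of_eventually_const (Filter.Eventually.of_forall fun _ => rfl) v
  simpa [hd] using h

/-- Smoothness of the partial sums is a hypothesis because additivity of `D` is only available for
smooth sections. -/
lemma toFun_sum_smul (hU : IsOpen U) (hx : x ∈ U) {ι : Type*} (A : Finset ι) {f : ι → M → ℝ}
    {e : ι → ∀ x : M, F.Normal x} (hf : ∀ i, ContMDiffOn (𝓡 (p + q)) 𝓘(ℝ, ℝ) ∞ (f i) U)
    (he : ∀ i, F.IsSmoothSection U (e i))
    (hsum : ∀ B : Finset ι, F.IsSmoothSection U (fun z => ∑ i ∈ B, f i z • e i z))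
    (v : TangentSpace (𝓡 (p + q)) x) :
    D.toFun (fun z => ∑ i ∈ A, f i z • e i z) x v =
      ∑ i ∈ A, (f i x • D.toFun (e i) x v + dirDeriv (f i) x v • e i x) := by
  classical
  induction A using Finset.induction_on with
  | empty => simpa using D.toFun_zero x v
  | insert i B hi ih =>
    have h1 := D.add U hU (fun z => f i z • e i z) (fun z => ∑ i ∈ B, f i z • e i z)
      (by simpa using hsum {i}) (hsum B) x hx v
    simp only [Finset.sum_insert hi]
    rw [h1, ih, D.leibniz U hU (f i) (e i) (hf i) (he i) x hx v]

/-- The covariant derivative in terms of components. -/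
lemma toFun_coord (hφ : IsAdaptedChart F.tangent φ) (hU : IsOpen U) (hUφ : U ⊆ φ.source)
    (hx : x ∈ U) {σ : M → Euc q} (hσ : ContMDiffOn (𝓡 (p + q)) 𝓘(ℝ, Euc q) ∞ σ U)
    (v : TangentSpace (𝓡 (p + q)) x) :
    D.toFun (fun z => F.coord φ (σ z) z) x v =
      F.coord φ (vecDeriv σ x v) x + D.toFun (F.coord φ (σ x)) x v := by
  set b := (EuclideanSpace.basisFun (Fin q) ℝ) with hb
  have hexp : ∀ (c : Euc q) z, F.coord φ c z = ∑ i, c i • F.coord φ (b i) z := fun c z => by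
    conv_lhs => rw [← F.coordₗ_apply, ← b.sum_repr c, map_sum]
    refine Finset.sum_congr rfl fun i _ => ?_
    rw [map_smul, hb, EuclideanSpace.basisFun_repr]
    rfl
  have main : ∀ τ : M → Euc q, ContMDiffOn (𝓡 (p + q)) 𝓘(ℝ, Euc q) ∞ τ U →
      D.toFun (fun z => F.coord φ (τ z) z) x v =
        ∑ i, τ x i • D.toFun (F.coord φ (b i)) x v + F.coord φ (vecDeriv τ x v) x := by
    intro τ hτ
    have hc : ∀ i, ContMDiffOn (𝓡 (p + q)) 𝓘(ℝ, ℝ) ∞ (fun z => τ z i) U := fun i =>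
      (EuclideanSpace.proj (𝕜 := ℝ) i : Euc q →L[ℝ] ℝ).contMDiff.comp_contMDiffOn hτ
    have hd : ∀ i, dirDeriv (fun z => τ z i) x v = (vecDeriv τ x v) i := fun i =>
      vecDeriv_clm_comp (EuclideanSpace.proj (𝕜 := ℝ) i : Euc q →L[ℝ] ℝ)
        ((hτ.contMDiffAt (hU.mem_nhds hx)).mdifferentiableAt (by simp)) v
    have h1 := D.toFun_sum_smul hU hx Finset.univ (f := fun i z => τ z i)
      (e := fun i => F.coord φ (b i)) hc
      (fun i => hφ.isSmoothSection_coord hU hUφ contMDiffOn_const) (fun B => ?_) v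
    · have h2 : (fun z => F.coord φ (τ z) z) = fun z => ∑ i, τ z i • F.coord φ (b i) z :=
        funext fun z => hexp _ z
      rw [h2, h1, Finset.sum_add_distrib, hexp (vecDeriv τ x v)]
      simp only [hd]
    · have h3 : ContMDiffOn (𝓡 (p + q)) 𝓘(ℝ, Euc q) ∞ (fun z => ∑ i ∈ B, τ z i • b i) U :=
        contMDiffOn_finsetSum fun i _ => (hc i).smul contMDiffOn_const
      refine (hφ.isSmoothSection_coord hU hUφ h3).congr fun z _ => ?_
      rw [← F.coordₗ_apply, map_sum]
      exact Finset.sum_congr rfl fun i _ => (map_smul (F.coordₗ φ z) (τ z i) (b i)).symm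
  -- The expansion is used for `σ` and for the constant map `σ x`: the zeroth-order sums agree, and
  -- the derivative of the constant vanishes.
  rw [main σ hσ, add_comm, main (fun _ => σ x) contMDiffOn_const,
    vecDeriv_of_eventually_const (Filter.Eventually.of_forall fun _ => rfl),
    ← F.coordₗ_apply φ x 0, map_zero, add_zero]

/-- The coordinate sections of `φ` are parallel. -/
def IsParallelChart (φ : OpenPartialHomeomorph M (Euc p × Euc q)) : Prop :=
  ∀ c : Euc q, ∀ x ∈ φ.source, ∀ v, D.toFun (F.coord φ c) x v = 0

variable {D}

/-- A connection with parallel coordinate sections near every point is flat. -/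
lemma curvature_eq_zero_of_isParallelChart (hφ : IsAdaptedChart F.tangent φ)
    (hpar : D.IsParallelChart φ) (hU : IsOpen U) (hxU : x ∈ U) (hx : x ∈ φ.source)
    {X Y : ∀ x : M, TangentSpace (𝓡 (p + q)) x} (hX : IsSmoothField U X)
    (hY : IsSmoothField U Y) (hs : F.IsSmoothSection U s) : D.curvature X Y s x = 0 := by
  set W := U ∩ φ.source with hW
  have hWo : IsOpen W := hU.inter φ.open_source
  have hWφ : W ⊆ φ.source := inter_subset_right
  have hxW : x ∈ W := ⟨hxU, hx⟩
  have hsW := hs.mono hWo (inter_subset_left : W ⊆ U)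
  have hXW := hX.mono (inter_subset_left : W ⊆ U)
  have hYW := hY.mono (inter_subset_left : W ⊆ U)
  obtain ⟨σ, hσ, hsσ⟩ := hφ.exists_eq_coord hWφ hsW
  -- In a parallel frame `D` is the ordinary derivative of components, so the curvature reduces to
  -- the commutator formula for `σ`.
  have hD : ∀ {t : ∀ x : M, F.Normal x} {τ : M → Euc q}, F.IsSmoothSection W t →
      ContMDiffOn (𝓡 (p + q)) 𝓘(ℝ, Euc q) ∞ τ W → (∀ z ∈ W, t z = F.coord φ (τ z) z) →
      ∀ z ∈ W, ∀ v, D.toFun t z v = F.coord φ (vecDeriv τ z v) z := by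
    intro t τ ht hτ h z hz v
    rw [D.toFun_congr hWo hz ht h, D.toFun_coord hφ hWo hWφ hz hτ, hpar _ _ (hWφ hz), add_zero]
  have hDD : ∀ {Z : ∀ x : M, TangentSpace (𝓡 (p + q)) x}, IsSmoothField W Z → ∀ v,
      D.toFun (fun z => D.toFun s z (Z z)) x v =
        F.coord φ (vecDeriv (fun z => vecDeriv σ z (Z z)) x v) x := fun hZ v =>
    hD (D.smooth W hWo _ s hZ hsW) (hZ.contMDiffOn_vecDeriv hWo hσ)
      (fun z hz => hD hsW hσ hsσ z hz _) x hxW v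
  rw [curvature, hDD hYW, hDD hXW, hD hsW hσ hsσ x hxW,
    hφ.isSmoothChart.vecDeriv_mlieBracket hx hWo hxW hXW hYW hσ]
  simp only [← F.coordₗ_apply, map_sub, sub_self]

end NormalConnection

end Connections

/-! ### Changes of transverse coordinates -/

section Transitions

variable {p q : ℕ} {M : Type*} [TopologicalSpace M] [ChartedSpace (Euc (p + q)) M]
  [IsManifold (𝓡 (p + q)) ∞ M] {F : Foliation p q M}
  {φ ψ : OpenPartialHomeomorph M (Euc p × Euc q)} {x z : M} {U : Set M}

/-- The Jacobian of the change of transverse coordinates from `φ` to `ψ`. -/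
noncomputable def transvJacobian (φ ψ : OpenPartialHomeomorph M (Euc p × Euc q)) (z : M) :
    Euc q →ₗ[ℝ] Euc q where
  toFun c := transv ψ z (coordVec φ ((0, c) : Euc p × Euc q) z)
  map_add' a b := by
    rw [← map_add, ← coordVec_add, Prod.mk_add_mk, add_zero]
  map_smul' r a := by
    rw [RingHom.id_apply, ← map_smul, ← coordVec_smul, Prod.smul_mk, smul_zero]

lemma transvJacobian_apply (c : Euc q) : transvJacobian φ ψ z c =
    transv ψ z (coordVec φ ((0, c) : Euc p × Euc q) z) := rfl

lemma IsAdaptedChart.coord_eq_coord (hψ : IsAdaptedChart F.tangent ψ) (hz : z ∈ ψ.source)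
    (c : Euc q) : F.coord φ c z = F.coord ψ (transvJacobian φ ψ z c) z :=
  hψ.mkQ_eq_coord hz (coordVec φ ((0, c) : Euc p × Euc q) z)

/-- A vector and the coordinate lift of its transverse part have the same class in the normal space.
-/
lemma transvJacobian_transv (hφ : IsAdaptedChart F.tangent φ) (hψ : IsAdaptedChart F.tangent ψ)
    (hz : z ∈ φ.source) (hz' : z ∈ ψ.source) (v : TangentSpace (𝓡 (p + q)) z) :
    transvJacobian φ ψ z (transv φ z v) = transv ψ z v := by
  refine hψ.coord_injective hz' ?_
  rw [← hψ.coord_eq_coord hz', ← hφ.mkQ_eq_coord hz, hψ.mkQ_eq_coord hz']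

lemma transvJacobian_injective (hφ : IsAdaptedChart F.tangent φ)
    (hψ : IsAdaptedChart F.tangent ψ) (hz : z ∈ φ.source) (hz' : z ∈ ψ.source) :
    Function.Injective (transvJacobian φ ψ z) := fun a b h =>
  hφ.coord_injective hz ((hψ.coord_eq_coord hz' a).trans
    ((congrArg (fun c => F.coord ψ c z) h).trans (hψ.coord_eq_coord hz' b).symm))

/-- Adapted charts with parallel coordinate sections are related by affine transformations. -/
lemma NormalConnection.exists_affineEquiv_of_isParallelChart [T2Space M] {D : NormalConnection F}
    (hφ : IsAdaptedChart F.tangent φ) (hψ : IsAdaptedChart F.tangent ψ)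
    (hφD : D.IsParallelChart φ) (hψD : D.IsParallelChart ψ) (hx : x ∈ φ.source ∩ ψ.source) :
    ∃ k : Euc q ≃ᵃ[ℝ] Euc q, ∀ᶠ z in 𝓝 x, (ψ z).2 = k (φ z).2 := by
  set W := φ.source ∩ ψ.source with hW
  have hWo : IsOpen W := φ.open_source.inter ψ.open_source
  have hσ : ∀ c, ContMDiffOn (𝓡 (p + q)) 𝓘(ℝ, Euc q) ∞ (fun z => transvJacobian φ ψ z c) W :=
    fun c => hψ.contMDiffOn_transv hWo inter_subset_right
      ((hφ.isSmoothField_coordVec (0, c)).mono inter_subset_left)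
  -- Differentiating `∂̄_c = ∑ (J c)ᵃ ∂̄'_a`, where both frames are parallel, leaves only the
  -- derivative of `J c`.
  have hd : ∀ c, ∀ z ∈ W, ∀ v : TangentSpace (𝓡 (p + q)) z,
      vecDeriv (fun z => transvJacobian φ ψ z c) z v = 0 := by
    intro c z hz v
    have h1 := D.toFun_congr hWo hz
      (hφ.isSmoothSection_coord hWo inter_subset_left (σ := fun _ => c) contMDiffOn_const)
      (fun z hz => hψ.coord_eq_coord hz.2 c) v
    rw [D.toFun_coord hψ hWo inter_subset_right hz (hσ c), hψD _ _ hz.2, add_zero] at h1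
    exact hψ.coord_eq_zero hz.2 (h1.symm.trans (hφD c z hz.1 v))
  have hconst : ∀ᶠ z in 𝓝 x, transvJacobian φ ψ z = transvJacobian φ ψ x := by
    have h1 : ∀ᶠ z in 𝓝 x, ∀ i, transvJacobian φ ψ z (EuclideanSpace.basisFun (Fin q) ℝ i) =
        transvJacobian φ ψ x (EuclideanSpace.basisFun (Fin q) ℝ i) := by
      rw [Filter.eventually_all]
      exact fun i => hφ.isSmoothChart.eventually_eq_of_vecDeriv_eq_zero hx.1
        ((hWo.eventually_mem hx).mono fun z hz =>
          ⟨((hσ _).contMDiffAt (hWo.mem_nhds hz)).mdifferentiableAt (by simp), hd _ z hz⟩)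
    filter_upwards [h1] with z hz
    refine (EuclideanSpace.basisFun (Fin q) ℝ).toBasis.ext fun i => ?_
    simpa using hz i
  set J := transvJacobian φ ψ x with hJ
  have hinj : Function.Injective J := transvJacobian_injective hφ hψ hx.1 hx.2
  have hsnd : ∀ z ∈ φ.source, MDifferentiableAt (𝓡 (p + q)) 𝓘(ℝ, Euc q) (fun z => (φ z).2) z :=
    fun z hz => (hφ.contMDiffOn_snd.contMDiffAt (φ.open_source.mem_nhds hz)).mdifferentiableAt
      (by simp)
  have hsnd' : ∀ z ∈ ψ.source, MDifferentiableAt (𝓡 (p + q)) 𝓘(ℝ, Euc q) (fun z => (ψ z).2) z :=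
    fun z hz => (hψ.contMDiffOn_snd.contMDiffAt (ψ.open_source.mem_nhds hz)).mdifferentiableAt
      (by simp)
  set L : Euc q →L[ℝ] Euc q := LinearMap.toContinuousLinearMap J with hL
  -- With `J` locally constant, `y' - J y` has zero derivative; its local value is the translation
  -- part of the affine map.
  have hfin := hφ.isSmoothChart.eventually_eq_of_vecDeriv_eq_zero (E' := Euc q)
    (f := fun z => (ψ z).2 - L (φ z).2) hx.1 (by
      filter_upwards [hWo.eventually_mem hx, hconst] with z hz hJz
      have h1 : MDifferentiableAt (𝓡 (p + q)) 𝓘(ℝ, Euc q) (fun z => L (φ z).2) z :=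
        L.differentiableAt.mdifferentiableAt.comp z (hsnd z hz.1)
      refine ⟨(hsnd' z hz.2).sub h1, fun v => ?_⟩
      have h2 : vecDeriv (fun z => (ψ z).2 - L (φ z).2) z v =
          transv ψ z v - vecDeriv (fun z => L (φ z).2) z v :=
        congrArg (fun A => A v) (mfderiv_sub (hsnd' z hz.2) h1)
      rw [h2, vecDeriv_clm_comp L (hsnd z hz.1), sub_eq_zero,
        ← transvJacobian_transv hφ hψ hz.1 hz.2, hJz]
      rfl)
  refine ⟨(LinearEquiv.ofInjectiveEndo J hinj).toAffineEquiv.trans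
    (AffineEquiv.constVAdd ℝ (Euc q) ((ψ x).2 - J (φ x).2)), ?_⟩
  filter_upwards [hfin] with z hz
  have h3 : (ψ z).2 - J (φ z).2 = (ψ x).2 - J (φ x).2 := hz
  rw [sub_eq_iff_eq_add] at h3
  simpa using h3

/-- The chart obtained from `φ` by restricting the leafwise coordinates to `B` and applying a
change of transverse coordinates. -/
noncomputable def changeTransverse (φ : OpenPartialHomeomorph M (Euc p × Euc q)) {B : Set (Euc p)}
    (hB : IsOpen B) (e : OpenPartialHomeomorph (Euc q) (Euc q)) :
    OpenPartialHomeomorph M (Euc p × Euc q) :=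
  φ.trans ((OpenPartialHomeomorph.ofSet B hB).prod e)

section changeTransverse

variable {B : Set (Euc p)} (hB : IsOpen B) {e : OpenPartialHomeomorph (Euc q) (Euc q)}

lemma changeTransverse_apply : changeTransverse φ hB e z = ((φ z).1, e (φ z).2) := rfl

lemma mem_changeTransverse_source : z ∈ (changeTransverse φ hB e).source ↔
    z ∈ φ.source ∧ (φ z).1 ∈ B ∧ (φ z).2 ∈ e.source := by
  simp [changeTransverse]

lemma changeTransverse_source_subset : (changeTransverse φ hB e).source ⊆ φ.source := fun _ hz =>
  ((mem_changeTransverse_source hB).1 hz).1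

lemma changeTransverse_target (hBe : B ×ˢ e.source ⊆ φ.target) :
    (changeTransverse φ hB e).target = B ×ˢ e.target := by
  ext ⟨u, y⟩
  constructor
  · rintro ⟨h, -⟩
    exact h
  · rintro ⟨hu, hy⟩
    exact ⟨⟨hu, hy⟩, hBe ⟨hu, e.map_target hy⟩⟩

lemma IsAdaptedChart.transv_changeTransverse (hφ : IsAdaptedChart F.tangent φ)
    (he : ContDiffOn ℝ ∞ e e.source) (hz : z ∈ (changeTransverse φ hB e).source)
    (v : TangentSpace (𝓡 (p + q)) z) :
    transv (changeTransverse φ hB e) z v = fderiv ℝ e (φ z).2 (transv φ z v) := by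
  obtain ⟨hzφ, -, hze⟩ := (mem_changeTransverse_source hB).1 hz
  have h1 : MDifferentiableAt 𝓘(ℝ, Euc q) 𝓘(ℝ, Euc q) e (φ z).2 :=
    ((he.contDiffAt (e.open_source.mem_nhds hze)).differentiableAt (by simp)).mdifferentiableAt
  have h2 : MDifferentiableAt (𝓡 (p + q)) 𝓘(ℝ, Euc q) (fun z => (φ z).2) z :=
    (hφ.contMDiffOn_snd.contMDiffAt (φ.open_source.mem_nhds hzφ)).mdifferentiableAt (by simp)
  have h3 := mfderiv_comp z (g := e) (f := fun z => (φ z).2) h1 h2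
  rw [mfderiv_eq_fderiv] at h3
  exact congrArg (fun A => A v) h3

/-- The new transverse differential is `de ∘ dy`, with the same kernel as `dy` because `de` is
injective. By `hBe` each nonempty plaque is a continuous image of the whole of `B`, hence connected.
-/
lemma IsAdaptedChart.changeTransverse (hφ : IsAdaptedChart F.tangent φ)
    (he : ContDiffOn ℝ ∞ e e.source) (he' : ContDiffOn ℝ ∞ e.symm e.target)
    (hBc : IsPreconnected B) (hBe : B ×ˢ e.source ⊆ φ.target) :
    IsAdaptedChart F.tangent (changeTransverse φ hB e) where
  contMDiffOn := by
    have h1 : ContDiffOn ℝ ∞ (fun w : Euc p × Euc q => (w.1, e w.2)) (B ×ˢ e.source) :=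
      contDiffOn_fst.prodMk (he.comp contDiffOn_snd fun w hw => hw.2)
    exact h1.contMDiffOn.comp (hφ.contMDiffOn.mono (changeTransverse_source_subset hB))
      fun z hz => ((mem_changeTransverse_source hB).1 hz).2
  contMDiffOn_symm := by
    rw [changeTransverse_target hB hBe]
    have h1 : ContDiffOn ℝ ∞ (fun w : Euc p × Euc q => (w.1, e.symm w.2)) (B ×ˢ e.target) :=
      contDiffOn_fst.prodMk (he'.comp contDiffOn_snd fun w hw => hw.2)
    exact hφ.contMDiffOn_symm.comp h1.contMDiffOn
      fun w hw => hBe ⟨hw.1, e.map_target hw.2⟩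
  mem_iff := by
    intro z hz v
    have hzφ := (mem_changeTransverse_source hB).1 hz
    rw [hφ.mem_tangent_iff hzφ.1]
    change _ ↔ transv (_root_.changeTransverse φ hB e) z v = 0
    rw [hφ.transv_changeTransverse hB he hz]
    have hinj : Function.Injective (fderiv ℝ e (φ z).2) := by
      have h1 : HasFDerivAt e (fderiv ℝ e (φ z).2) (φ z).2 :=
        ((he.contDiffAt (e.open_source.mem_nhds hzφ.2.2)).differentiableAt (by simp)).hasFDerivAt
      have h2 : HasFDerivAt e.symm (fderiv ℝ e.symm (e (φ z).2)) (e (φ z).2) :=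
        ((he'.contDiffAt (e.open_target.mem_nhds (e.map_source hzφ.2.2))).differentiableAt
          (by simp)).hasFDerivAt
      have h3 : HasFDerivAt (id : Euc q → Euc q) ((fderiv ℝ e.symm (e (φ z).2)).comp
          (fderiv ℝ e (φ z).2)) (φ z).2 :=
        (h2.comp _ h1).congr_of_eventuallyEq
          ((e.open_source.eventually_mem hzφ.2.2).mono fun w hw => (e.left_inv hw).symm)
      have h4 := h3.unique (hasFDerivAt_id _)
      exact Function.LeftInverse.injective (g := fderiv ℝ e.symm (e (φ z).2))
        fun u => congrArg (fun A => A u) h4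
    rw [map_eq_zero_iff _ hinj]
  plaques := by
    intro c
    by_cases hc : c ∈ e.target
    · have h1 : {z ∈ (_root_.changeTransverse φ hB e).source |
          (_root_.changeTransverse φ hB e z).2 = c} =
          (fun u => φ.symm (u, e.symm c)) '' B := by
        ext z
        constructor
        · rintro ⟨hz, rfl⟩
          obtain ⟨hzφ, hzB, hze⟩ := (mem_changeTransverse_source hB).1 hz
          refine ⟨(φ z).1, hzB, ?_⟩
          simp only [changeTransverse_apply, e.left_inv hze]
          exact φ.left_inv hzφ
        · rintro ⟨u, hu, rfl⟩
          have hw : (u, e.symm c) ∈ φ.target := hBe ⟨hu, e.map_target hc⟩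
          refine ⟨(mem_changeTransverse_source hB).2 ⟨φ.map_target hw, ?_⟩, ?_⟩
          · simp only [φ.right_inv hw]
            exact ⟨hu, e.map_target hc⟩
          · simp only [changeTransverse_apply, φ.right_inv hw, e.right_inv hc]
      rw [h1]
      exact hBc.image _ (φ.continuousOn_symm.comp (by fun_prop)
        fun u hu => hBe ⟨hu, e.map_target hc⟩)
    · convert isPreconnected_empty
      ext z
      simp only [mem_ofPred_eq, mem_empty_iff_false, iff_false, not_and]
      rintro hz rfl
      exact hc (e.map_source ((mem_changeTransverse_source hB).1 hz).2.2)

end changeTransverse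

end Transitions

/-! ### Christoffel symbols of a normal connection -/

section Christoffel

variable {p q : ℕ} {M : Type*} [TopologicalSpace M] [T2Space M] [ChartedSpace (Euc (p + q)) M]
  [IsManifold (𝓡 (p + q)) ∞ M] {F : Foliation p q M}
  {φ ψ : OpenPartialHomeomorph M (Euc p × Euc q)} {x z : M} {U : Set M}
  {D : NormalConnection F} {g : NormalMetric F}
  {E' : Type*} [NormedAddCommGroup E'] [NormedSpace ℝ E']

lemma IsAdaptedChart.vecDeriv_comp_transv (hφ : IsAdaptedChart F.tangent φ) (hz : z ∈ φ.source)
    {u : Euc q → E'} (hu : DifferentiableAt ℝ u (φ z).2) (v : TangentSpace (𝓡 (p + q)) z) :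
    vecDeriv (fun z => u (φ z).2) z v = fderiv ℝ u (φ z).2 (transv φ z v) := by
  have h2 : MDifferentiableAt (𝓡 (p + q)) 𝓘(ℝ, Euc q) (fun z => (φ z).2) z :=
    (hφ.contMDiffOn_snd.contMDiffAt (φ.open_source.mem_nhds hz)).mdifferentiableAt (by simp)
  have h3 := mfderiv_comp z (g := u) (f := fun z => (φ z).2) hu.mdifferentiableAt h2
  rw [mfderiv_eq_fderiv] at h3
  exact congrArg (fun A => A v) h3

/-- A field of bilinear maps on the domain of a chart, read in the chart, is smooth if its
coefficients are. -/
lemma IsSmoothChart.contDiffOn_bilinear (hφ : IsSmoothChart (p := p) (q := q) φ)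
    {β : M → Euc q →L[ℝ] Euc q →L[ℝ] E'}
    (hβ : ∀ a b, ContMDiffOn (𝓡 (p + q)) 𝓘(ℝ, E') ∞ (fun z => β z a b) φ.source) :
    ContDiffOn ℝ ∞ (β ∘ φ.symm) φ.target := by
  rw [contDiffOn_clm_apply]
  intro a
  rw [contDiffOn_clm_apply]
  intro b
  exact ((hβ a b).comp hφ.contMDiffOn_symm fun w hw => φ.map_target hw).contDiffOn

lemma IsSmoothChart.vecDeriv_bilinear (hφ : IsSmoothChart (p := p) (q := q) φ)
    {β : M → Euc q →L[ℝ] Euc q →L[ℝ] E'}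
    (hβ : ∀ a b, ContMDiffOn (𝓡 (p + q)) 𝓘(ℝ, E') ∞ (fun z => β z a b) φ.source)
    (hz : z ∈ φ.source) (w : Euc p × Euc q) (a b : Euc q) :
    vecDeriv (p := p) (q := q) (fun z => β z a b) z (coordVec φ w z) =
      fderiv ℝ (β ∘ φ.symm) (φ z) w a b := by
  rw [hφ.vecDeriv_apply_coordVec hz
    (((hβ a b).contMDiffAt (φ.open_source.mem_nhds hz)).mdifferentiableAt (by simp))]
  have h1 := (((hφ.contDiffOn_bilinear hβ).contDiffAt
    (φ.open_target.mem_nhds (φ.map_source hz))).differentiableAt (by simp)).hasFDerivAt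
  have h2 := (h1.clm_apply (hasFDerivAt_const a (φ z))).clm_apply (hasFDerivAt_const b (φ z))
  have h3 := congrArg (fun A => A w) h2.fderiv
  simpa [Function.comp_def] using h3

/-- A linear map of two arguments as a continuous bilinear map. -/
noncomputable def bilinearToCLM (β : Euc q →ₗ[ℝ] Euc q →ₗ[ℝ] E') :
    Euc q →L[ℝ] Euc q →L[ℝ] E' :=
  LinearMap.toContinuousLinearMap
    ((LinearMap.toContinuousLinearMap (𝕜 := ℝ) (E := Euc q) (F' := E')).toLinearMap.comp β)

/-- `γ` is the field of Christoffel symbols of `D` in the chart `φ`. -/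
structure NormalConnection.IsChristoffel (D : NormalConnection F)
    (φ : OpenPartialHomeomorph M (Euc p × Euc q)) (γ : M → Euc q →L[ℝ] Euc q →L[ℝ] Euc q) :
    Prop where
  contMDiffOn : ∀ a b, ContMDiffOn (𝓡 (p + q)) 𝓘(ℝ, Euc q) ∞ (fun z => γ z a b) φ.source
  toFun_eq : ∀ z ∈ φ.source, ∀ v c, D.toFun (F.coord φ c) z v = F.coord φ (γ z (transv φ z v) c) z

namespace NormalConnection

/-- Normality makes `D_v ∂̄_c` depend only on `dy(v)`, so the components of `D` along the transverse
coordinate fields determine it. -/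
lemma exists_isChristoffel (hφ : IsAdaptedChart F.tangent φ) (hD : D.IsNormal) :
    ∃ γ, D.IsChristoffel φ γ := by
  have hsec : ∀ c, F.IsSmoothSection φ.source (F.coord φ c) := fun c =>
    hφ.isSmoothSection_coord φ.open_source subset_rfl (σ := fun _ => c) contMDiffOn_const
  have hex : ∀ b c, ∃ σ : M → Euc q, ContMDiffOn (𝓡 (p + q)) 𝓘(ℝ, Euc q) ∞ σ φ.source ∧
      ∀ z ∈ φ.source, D.toFun (F.coord φ c) z (coordVec φ ((0, b) : Euc p × Euc q) z) =
        F.coord φ (σ z) z := fun b c =>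
    hφ.exists_eq_coord subset_rfl
      (D.smooth φ.source φ.open_source _ _ (hφ.isSmoothField_coordVec (0, b)) (hsec c))
  choose κ hκs hκ using hex
  have hadd : ∀ z ∈ φ.source, ∀ c c' v, D.toFun (F.coord φ (c + c')) z v =
      D.toFun (F.coord φ c) z v + D.toFun (F.coord φ c') z v := fun z hz c c' v => by
    rw [← D.add φ.source φ.open_source _ _ (hsec c) (hsec c') z hz v]
    exact congrArg (fun s => D.toFun s z v) (funext fun z => Foliation.coord_add φ c c' z)
  have hsmul : ∀ z ∈ φ.source, ∀ (r : ℝ) c v, D.toFun (F.coord φ (r • c)) z v =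
      r • D.toFun (F.coord φ c) z v := fun z hz r c v => by
    have h1 := D.leibniz φ.source φ.open_source (fun _ => r) _ contMDiffOn_const (hsec c) z hz v
    have h2 : dirDeriv (fun _ : M => r) z v = 0 :=
      vecDeriv_of_eventually_const (Filter.Eventually.of_forall fun _ => rfl) v
    rw [h2, zero_smul, add_zero] at h1
    rw [← h1]
    exact congrArg (fun s => D.toFun s z v) (funext fun z => Foliation.coord_smul φ r c z)
  classical
  -- Bilinearity of the components is read off from injectivity of `F.coord φ`, which holds on
  -- `φ.source`; the value `0` elsewhere plays no role.
  let γ : M → Euc q →L[ℝ] Euc q →L[ℝ] Euc q := fun z =>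
    if hz : z ∈ φ.source then bilinearToCLM (LinearMap.mk₂ ℝ (fun b c => κ b c z)
      (fun b b' c => hφ.coord_injective hz (by
        have h := coordVec_add (p := p) (q := q) (φ := φ) (0, b) (0, b') z
        rw [Prod.mk_add_mk, add_zero] at h
        rw [Foliation.coord_add, ← hκ _ _ z hz, ← hκ _ _ z hz, ← hκ _ _ z hz, h, map_add]))
      (fun r b c => hφ.coord_injective hz (by
        have h := coordVec_smul (p := p) (q := q) (φ := φ) r (0, b) z
        rw [Prod.smul_mk, smul_zero] at h
        rw [Foliation.coord_smul, ← hκ _ _ z hz, ← hκ _ _ z hz, h, map_smul]))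
      (fun b c c' => hφ.coord_injective hz (by
        rw [Foliation.coord_add, ← hκ _ _ z hz, ← hκ _ _ z hz, ← hκ _ _ z hz, hadd z hz]))
      (fun r b c => hφ.coord_injective hz (by
        rw [Foliation.coord_smul, ← hκ _ _ z hz, ← hκ _ _ z hz, hsmul z hz]))) else 0
  have hγ : ∀ z ∈ φ.source, ∀ b c, γ z b c = κ b c z := fun z hz b c => by
    simp only [γ, dif_pos hz]
    rfl
  refine ⟨γ, fun a b => (hκs a b).congr fun z hz => hγ z hz a b, fun z hz v c => ?_⟩
  rw [hγ z hz, ← hκ _ _ z hz, ← sub_eq_zero, ← map_sub]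
  refine hD φ.source φ.open_source _ (hφ.isFoliatedSection_coord c) z hz _ ?_
  rw [hφ.mem_tangent_iff hz, map_sub, hφ.transv_coordVec hz, sub_self]

variable {γ : M → Euc q →L[ℝ] Euc q →L[ℝ] Euc q}

/-- The torsion equation for coordinate fields, whose bracket is zero in the normal bundle. -/
lemma IsChristoffel.symm (hγ : D.IsChristoffel φ γ) (hφ : IsAdaptedChart F.tangent φ)
    (hD : D.IsTorsionFree) (hz : z ∈ φ.source) (a b : Euc q) : γ z a b = γ z b a := by
  have h := hD φ.source φ.open_source _ _ (hφ.isSmoothField_coordVec (0, a))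
    (hφ.isSmoothField_coordVec (0, b)) z hz
  rw [Foliation.bar_coordVec, Foliation.bar_coordVec, hγ.toFun_eq z hz, hγ.toFun_eq z hz,
    hφ.transv_coordVec hz, hφ.transv_coordVec hz] at h
  have h0 : F.bar (VectorField.mlieBracket (𝓡 (p + q)) (coordVec φ ((0, a) : Euc p × Euc q))
      (coordVec φ ((0, b) : Euc p × Euc q))) z = 0 :=
    (Submodule.Quotient.mk_eq_zero _).2 (hφ.mlieBracket_coordVec_mem hz _ _)
  rw [h0, sub_eq_zero] at h
  exact hφ.coord_injective hz h

/-- The zero-curvature equation for coordinate fields. Leafwise components of `w` and `w'` are kept,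
because the mixed directions later show that `γ` is constant along plaques. -/
lemma IsChristoffel.flat (hγ : D.IsChristoffel φ γ) (hφ : IsAdaptedChart F.tangent φ)
    (hD : HasConstantCurvature D g 0) {m : Euc p × Euc q} (hm : m ∈ φ.target)
    (w w' : Euc p × Euc q) (c : Euc q) :
    fderiv ℝ (γ ∘ φ.symm) m w w'.2 c + γ (φ.symm m) w.2 (γ (φ.symm m) w'.2 c) =
      fderiv ℝ (γ ∘ φ.symm) m w' w.2 c + γ (φ.symm m) w'.2 (γ (φ.symm m) w.2 c) := by
  obtain ⟨z, hz, rfl⟩ : ∃ z ∈ φ.source, φ z = m := ⟨_, φ.map_target hm, φ.right_inv hm⟩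
  rw [φ.left_inv hz]
  have hsec : ∀ c, F.IsSmoothSection φ.source (F.coord φ c) := fun c =>
    hφ.isSmoothSection_coord φ.open_source subset_rfl (σ := fun _ => c) contMDiffOn_const
  have h := hD φ.source φ.open_source _ _ _ (hφ.isSmoothField_coordVec w)
    (hφ.isSmoothField_coordVec w') (hsec c) z hz
  have hDD : ∀ w w' : Euc p × Euc q,
      D.toFun (fun z => D.toFun (F.coord φ c) z (coordVec φ w' z)) z (coordVec φ w z) =
        F.coord φ (fderiv ℝ (γ ∘ φ.symm) (φ z) w w'.2 c + γ z w.2 (γ z w'.2 c)) z := by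
    intro w w'
    rw [D.toFun_congr φ.open_source hz
      (D.smooth φ.source φ.open_source _ _ (hφ.isSmoothField_coordVec w') (hsec c))
      (t := fun z => F.coord φ (γ z w'.2 c) z)
      (fun z hz => by rw [hγ.toFun_eq z hz, hφ.transv_coordVec hz]),
      D.toFun_coord hφ φ.open_source subset_rfl hz (hγ.contMDiffOn _ _), hγ.toFun_eq z hz,
      hφ.transv_coordVec hz, hφ.isSmoothChart.vecDeriv_bilinear hγ.contMDiffOn hz,
      Foliation.coord_add]
  rw [NormalConnection.curvature, hDD, hDD, zero_smul, hγ.toFun_eq z hz,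
    (hφ.mem_tangent_iff hz _).1 (hφ.mlieBracket_coordVec_mem hz w w'), map_zero] at h
  have h0 : F.coord φ ((0 : Euc q →L[ℝ] Euc q) c) z = 0 := map_zero (F.coordₗ φ z)
  rw [h0, sub_zero, sub_eq_zero] at h
  exact hφ.coord_injective hz h

end NormalConnection

end Christoffel

/-! ### Parallel charts, Hessian potentials and the affine atlas -/

section HessianCharts

open Metric

variable {p q : ℕ} {M : Type*} [TopologicalSpace M] [T2Space M] [ChartedSpace (Euc (p + q)) M]
  [IsManifold (𝓡 (p + q)) ∞ M] {F : Foliation p q M}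
  {φ ψ : OpenPartialHomeomorph M (Euc p × Euc q)} {x z : M}
  {D : NormalConnection F} {g : NormalMetric F}
  {E' : Type*} [NormedAddCommGroup E'] [NormedSpace ℝ E']

/-- A function on a product whose derivative vanishes in the directions of the first factor only
depends on the second variable. -/
lemma eq_of_fderiv_left_eq_zero {A B E' : Type*} [NormedAddCommGroup A] [NormedSpace ℝ A]
    [NormedAddCommGroup B] [NormedSpace ℝ B] [NormedAddCommGroup E'] [NormedSpace ℝ E']
    {H : A × B → E'} {S : Set A} (hS : IsOpen S) (hSc : Convex ℝ S) {y : B}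
    (hH : ∀ u ∈ S, DifferentiableAt ℝ H (u, y))
    (h0 : ∀ u ∈ S, ∀ a, fderiv ℝ H (u, y) (a, 0) = 0) {u u' : A} (hu : u ∈ S) (hu' : u' ∈ S) :
    H (u, y) = H (u', y) := by
  have hd : ∀ u ∈ S, HasFDerivAt (fun u => H (u, y)) (0 : A →L[ℝ] E') u := by
    intro u hu
    have h1 : HasFDerivAt (fun u => H (u, y)) _ u :=
      (hH u hu).hasFDerivAt.comp (f := fun u : A => (u, y)) u
        (hasFDerivAt_prodMk_left (𝕜 := ℝ) u y)
    refine h1.congr_fderiv ?_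
    ext a
    simpa using h0 u hu a
  exact hSc.is_const_of_fderivWithin_eq_zero (𝕜 := ℝ) (f := fun u => H (u, y))
    (fun w hw => (hd w hw).differentiableAt.differentiableWithinAt)
    (fun w hw => by rw [fderivWithin_of_isOpen hS hw, (hd w hw).fderiv]) hu hu'

lemma fderiv_comp_prodMk_right {A B E' : Type*} [NormedAddCommGroup A] [NormedSpace ℝ A]
    [NormedAddCommGroup B] [NormedSpace ℝ B] [NormedAddCommGroup E'] [NormedSpace ℝ E']
    {H : A × B → E'} {u : A} {y : B} (hH : DifferentiableAt ℝ H (u, y)) (b : B) :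
    fderiv ℝ (fun y => H (u, y)) y b = fderiv ℝ H (u, y) (0, b) := by
  have h1 := hH.hasFDerivAt.comp y (hasFDerivAt_prodMk_right u y)
  have h2 : fderiv ℝ (fun y => H (u, y)) y = _ := h1.fderiv
  rw [h2]
  simp

/-- Flat Christoffel symbols which only involve the second factor are constant along the first. -/
lemma eq_of_flat {A B : Type*} [NormedAddCommGroup A] [NormedSpace ℝ A]
    [NormedAddCommGroup B] [NormedSpace ℝ B] {Γ : A × B → B →L[ℝ] B →L[ℝ] B} {S : Set A}
    (hS : IsOpen S) (hSc : Convex ℝ S) {y : B} (hΓ : ∀ u ∈ S, DifferentiableAt ℝ Γ (u, y))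
    (hflat : ∀ u ∈ S, ∀ w w' : A × B, ∀ c,
      fderiv ℝ Γ (u, y) w w'.2 c + Γ (u, y) w.2 (Γ (u, y) w'.2 c) =
        fderiv ℝ Γ (u, y) w' w.2 c + Γ (u, y) w'.2 (Γ (u, y) w.2 c))
    {u u' : A} (hu : u ∈ S) (hu' : u' ∈ S) : Γ (u, y) = Γ (u', y) := by
  refine eq_of_fderiv_left_eq_zero hS hSc hΓ (fun u hu a => ?_) hu hu'
  ext b c
  simpa using hflat u hu (a, 0) (0, b) c

/-- A flat torsion-free normal connection has parallel adapted charts whose image is a product of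
balls. -/
lemma NormalConnection.exists_isParallelChart (hD : D.IsNormal) (hT : D.IsTorsionFree)
    (hR : HasConstantCurvature D g 0) (x : M) :
    ∃ ψ : OpenPartialHomeomorph M (Euc p × Euc q), x ∈ ψ.source ∧ IsAdaptedChart F.tangent ψ ∧
      D.IsParallelChart ψ ∧ ∃ r > 0, ∃ ρ > 0, ψ.target = ball (ψ x).1 r ×ˢ ball (ψ x).2 ρ := by
  obtain ⟨φ, hx, hφ⟩ := F.exists_chart x
  obtain ⟨γ, hγ⟩ := D.exists_isChristoffel hφ hD
  set Γ := γ ∘ φ.symm with hΓdef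
  have hΓ : ContDiffOn ℝ ∞ Γ φ.target := hφ.isSmoothChart.contDiffOn_bilinear hγ.contMDiffOn
  have hΓd : ∀ m ∈ φ.target, DifferentiableAt ℝ Γ m := fun m hm =>
    (hΓ.contDiffAt (φ.open_target.mem_nhds hm)).differentiableAt (by simp)
  have hflat : ∀ m ∈ φ.target, ∀ w w' : Euc p × Euc q, ∀ c,
      fderiv ℝ Γ m w w'.2 c + Γ m w.2 (Γ m w'.2 c) =
        fderiv ℝ Γ m w' w.2 c + Γ m w'.2 (Γ m w.2 c) := fun m hm w w' c =>
    hγ.flat hφ hR hm w w' c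
  obtain ⟨r, hr, hball⟩ := Metric.isOpen_iff.1 φ.open_target _ (φ.map_source hx)
  rw [← Prod.mk.eta (p := φ x), ← ball_prod_same] at hball
  set u₀ := (φ x).1 with hu₀
  set y₀ := (φ x).2 with hy₀
  have hu₀m : u₀ ∈ ball u₀ r := mem_ball_self hr
  have hconst : ∀ u ∈ ball u₀ r, ∀ y ∈ ball y₀ r, Γ (u, y) = Γ (u₀, y) := fun u hu y hy =>
    eq_of_flat isOpen_ball (convex_ball u₀ r) (fun u hu => hΓd _ (hball ⟨hu, hy⟩))
      (fun u hu => hflat _ (hball ⟨hu, hy⟩)) hu hu₀m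
  have hmem : ∀ y ∈ ball y₀ r, (u₀, y) ∈ φ.target := fun y hy => hball ⟨hu₀m, hy⟩
  -- By `hconst` the symbols on the slice `u = u₀` are those on every plaque, so affine coordinates
  -- for the slice serve the whole product.
  obtain ⟨e, hye, hes, ⟨ρ, hρ, het⟩, he, he', hee⟩ := exists_affineCoordinates
    (γ := fun y => Γ (u₀, y)) (s := ball y₀ r) (y₀ := y₀) isOpen_ball
    (hΓ.comp (by fun_prop) hmem)
    (fun y hy a b => hγ.symm hφ hT (φ.map_target (hmem y hy)) a b)
    (fun y hy a b c => by
      have hd : DifferentiableAt ℝ Γ (u₀, y) := hΓd _ (hmem y hy)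
      rw [fderiv_comp_prodMk_right hd, fderiv_comp_prodMk_right hd]
      exact hflat _ (hmem y hy) (0, a) (0, b) c)
    (mem_ball_self hr)
  have hBe : ball u₀ r ×ˢ e.source ⊆ φ.target := (prod_mono_right hes).trans hball
  set ψ := changeTransverse φ (isOpen_ball : IsOpen (ball u₀ r)) e with hψdef
  have hψ : IsAdaptedChart F.tangent ψ :=
    hφ.changeTransverse isOpen_ball he he' (convex_ball u₀ r).isPreconnected hBe
  have hsub : ψ.source ⊆ φ.source := changeTransverse_source_subset _
  refine ⟨ψ, (mem_changeTransverse_source _).2 ⟨hx, hu₀m, hye⟩, hψ, ?_, r, hr, ρ, hρ, ?_⟩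
  · intro c z hz v
    obtain ⟨hzφ, hzB, hze⟩ := (mem_changeTransverse_source isOpen_ball).1 hz
    have hJ : ∀ a, ∀ z ∈ ψ.source, transvJacobian φ ψ z a = fderiv ℝ e (φ z).2 a := by
      intro a z hz
      rw [transvJacobian_apply, hφ.transv_changeTransverse isOpen_ball he hz,
        hφ.transv_coordVec (hsub hz)]
    have hcd : ∀ a, ∀ z ∈ ψ.source, F.coord φ a z = F.coord ψ (fderiv ℝ e (φ z).2 a) z := by
      intro a z hz
      rw [hψ.coord_eq_coord hz, hJ a z hz]
    have hfe : ContDiffOn ℝ ∞ (fderiv ℝ e) e.source :=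
      he.fderiv_of_isOpen e.open_source (by simp)
    have hfs : ∀ a, ContDiffOn ℝ ∞ (fun y => fderiv ℝ e y a) e.source := fun a =>
      hfe.clm_apply contDiffOn_const
    have hsm : ∀ a, ContMDiffOn (𝓡 (p + q)) 𝓘(ℝ, Euc q) ∞ (fun z => fderiv ℝ e (φ z).2 a)
        ψ.source := fun a =>
      (hfs a).contMDiffOn.comp (hφ.contMDiffOn_snd.mono hsub)
        fun z hz => ((mem_changeTransverse_source isOpen_ball).1 hz).2.2
    -- The old coordinate section of `a` has components `de a` in the new frame. Computing its
    -- covariant derivative in both frames, the defining equation `d²e(a, b) = de(γ(a, b))` cancels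
    -- everything except the derivative of the new frame.
    have hpar : ∀ a, D.toFun (F.coord ψ (fderiv ℝ e (φ z).2 a)) z v = 0 := by
      intro a
      have h1 := D.toFun_congr ψ.open_source hz
        (hφ.isSmoothSection_coord ψ.open_source hsub (σ := fun _ => a) contMDiffOn_const)
        (hcd a) v
      rw [D.toFun_coord hψ ψ.open_source subset_rfl hz (hsm a), hγ.toFun_eq z hzφ,
        hφ.vecDeriv_comp_transv hzφ (u := fun y => fderiv ℝ e y a)
          (((hfs a).contDiffAt (e.open_source.mem_nhds hze)).differentiableAt (by simp)),
        hcd _ z hz] at h1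
      have h2 : fderiv ℝ (fun y => fderiv ℝ e y a) (φ z).2 (transv φ z v) =
          fderiv ℝ e (φ z).2 (γ z (transv φ z v) a) := by
        have h3 : HasFDerivAt (fderiv ℝ e) _ (φ z).2 :=
          ((hfe.contDiffAt (e.open_source.mem_nhds hze)).differentiableAt (by simp)).hasFDerivAt
        rw [(h3.clm_apply (hasFDerivAt_const a _)).fderiv]
        have h4 := hee _ hze (transv φ z v) a
        rw [← hconst _ hzB _ (hes hze), hΓdef, Function.comp_apply, Prod.mk.eta,
          φ.left_inv hzφ] at h4
        simpa using h4
      rw [h2] at h1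
      simpa using h1
    have hsurj : Function.Surjective (transvJacobian φ ψ z) :=
      LinearMap.injective_iff_surjective.1 (transvJacobian_injective hφ hψ hzφ hz)
    obtain ⟨a, rfl⟩ := hsurj c
    rw [hJ a z hz]
    exact hpar a
  · rw [changeTransverse_target _ hBe, het]
    rfl

/-- In a parallel chart with convex image, the metric of a Codazzi structure is a Hessian. -/
lemma IsFoliatedCodazzi.exists_hessian (h : IsFoliatedCodazzi D g)
    (hψ : IsAdaptedChart F.tangent ψ) (hpar : D.IsParallelChart ψ) {S : Set (Euc p)}
    {T : Set (Euc q)} (hS : IsOpen S) (hSc : Convex ℝ S) (hSn : S.Nonempty) (hT : IsOpen T)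
    (hTc : Convex ℝ T) (htarget : ψ.target = S ×ˢ T) :
    ∃ h : Euc q → ℝ, ContDiffOn ℝ ∞ h T ∧ ∀ x ∈ ψ.source, ∀ a b : Euc q,
      g.inner x (F.coord ψ a x) (F.coord ψ b x) =
        fderiv ℝ (fun y => fderiv ℝ h y a) (ψ x).2 b := by
  obtain ⟨u₀, hu₀⟩ := hSn
  let β : M → Euc q →L[ℝ] Euc q →L[ℝ] ℝ := fun z =>
    bilinearToCLM ((g.inner z).compl₁₂ (F.coordₗ ψ z) (F.coordₗ ψ z))
  have hβa : ∀ z a b, β z a b = g.inner z (F.coord ψ a z) (F.coord ψ b z) := fun _ _ _ => rfl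
  have hsec : ∀ c, F.IsSmoothSection ψ.source (F.coord ψ c) := fun c =>
    hψ.isSmoothSection_coord ψ.open_source subset_rfl (σ := fun _ => c) contMDiffOn_const
  have hβ : ∀ a b, ContMDiffOn (𝓡 (p + q)) 𝓘(ℝ, ℝ) ∞ (fun z => β z a b) ψ.source := fun a b =>
    g.smooth ψ.source ψ.open_source _ _ (hsec a) (hsec b)
  set H := β ∘ ψ.symm with hH
  have hHs : ContDiffOn ℝ ∞ H (S ×ˢ T) := htarget ▸ hψ.isSmoothChart.contDiffOn_bilinear hβ
  have hHd : ∀ m ∈ S ×ˢ T, DifferentiableAt ℝ H m := fun m hm =>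
    (hHs.contDiffAt ((hS.prod hT).mem_nhds hm)).differentiableAt (by simp)
  have hder : ∀ m ∈ S ×ˢ T, ∃ z ∈ ψ.source, ψ z = m ∧ ∀ w a b,
      vecDeriv (p := p) (q := q) (fun z => β z a b) z (coordVec ψ w z) = fderiv ℝ H m w a b := by
    intro m hm
    rw [← htarget] at hm
    refine ⟨_, ψ.map_target hm, ψ.right_inv hm, fun w a b => ?_⟩
    rw [hψ.isSmoothChart.vecDeriv_bilinear hβ (ψ.map_target hm), ψ.right_inv hm]
  -- Basicness of the coefficients may be witnessed in another adapted chart `χ`; leafwise vectors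
  -- of `ψ` are also annihilated by the transverse differential of `χ`.
  have hleft : ∀ m ∈ S ×ˢ T, ∀ u, fderiv ℝ H m (u, 0) = 0 := by
    intro m hm u
    obtain ⟨z, hz, -, hzd⟩ := hder m hm
    ext1 a
    ext1 b
    rw [← hzd]
    obtain ⟨χ, hzχ, hχψ, hχ, f, hf, hfχ⟩ := h.foliated_metric ψ.source ψ.open_source _ _
      (hψ.isFoliatedSection_coord a) (hψ.isFoliatedSection_coord b) z hz
    have h1 : (fun z => β z a b) =ᶠ[𝓝 z] fun z => f (χ z).2 :=
      (χ.open_source.eventually_mem hzχ).mono fun z hz => hfχ z hz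
    have h2 : DifferentiableAt ℝ f (χ z).2 :=
      (hf.contDiffAt ((isOpenMap_snd _ χ.open_target).mem_nhds
        ⟨_, χ.map_source hzχ, rfl⟩)).differentiableAt (by simp)
    rw [vecDeriv_congr h1, hχ.vecDeriv_comp_transv hzχ h2,
      (hχ.mem_tangent_iff hzχ _).1 (hψ.coordVec_left_mem hz u), map_zero]
    rfl
  -- Coordinate fields are infinitesimal automorphisms, and in a parallel chart the `D` terms of the
  -- Codazzi equation vanish, leaving derivatives of coefficients.
  have hcod : ∀ m ∈ S ×ˢ T, ∀ a b c, fderiv ℝ H m (0, a) b c = fderiv ℝ H m (0, b) a c := by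
    intro m hm a b c
    obtain ⟨z, hz, -, hzd⟩ := hder m hm
    have h1 := h.codazzi ψ.source ψ.open_source _ _ _ (hψ.isInfinitesimalAut_coordVec (0, a))
      (hψ.isInfinitesimalAut_coordVec (0, b)) (hψ.isFoliatedSection_coord c) z hz
    simp only [NormalConnection.derivMetric, Foliation.bar_coordVec, hpar _ z hz, map_zero,
      LinearMap.zero_apply, sub_zero] at h1
    rw [← hzd, ← hzd]
    exact h1
  have hconst : ∀ u ∈ S, ∀ y ∈ T, H (u, y) = H (u₀, y) := fun u hu y hy =>
    eq_of_fderiv_left_eq_zero hS hSc (fun u hu => hHd _ ⟨hu, hy⟩)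
      (fun u hu a => hleft _ ⟨hu, hy⟩ a) hu hu₀
  obtain ⟨f, hf, hfH⟩ := exists_hessian_eq (G := fun y => H (u₀, y)) hT hTc
    (hHs.comp (by fun_prop) fun y hy => ⟨hu₀, hy⟩) (fun y _ a b => g.symm _ _ _)
    (fun y hy a b => by
      have hd := hHd _ (⟨hu₀, hy⟩ : (u₀, y) ∈ S ×ˢ T)
      rw [fderiv_comp_prodMk_right hd, fderiv_comp_prodMk_right hd]
      ext c
      exact hcod _ ⟨hu₀, hy⟩ a b c)
  refine ⟨f, hf, fun z hz a b => ?_⟩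
  have hm : ψ z ∈ S ×ˢ T := htarget ▸ ψ.map_source hz
  rw [hfH _ hm.2, ← hconst _ hm.1 _ hm.2, Prod.mk.eta, hH, Function.comp_apply, ψ.left_inv hz, hβa]

/-- A flat Codazzi structure has a transversely affine atlas of parallel Hessian charts. -/
lemma IsFoliatedCodazzi.exists_atlas (h : IsFoliatedCodazzi D g)
    (hR : HasConstantCurvature D g 0) :
    ∃ A : Set (OpenPartialHomeomorph M (Euc p × Euc q)), IsTransverselyAffineAtlas F A ∧
      ∀ φ ∈ A, (∀ c : Euc q, ∀ x ∈ φ.source, ∀ v, D.toFun (F.coord φ c) x v = 0) ∧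
        ∃ h : Euc q → ℝ, ContDiffOn ℝ ∞ h (Prod.snd '' φ.target) ∧
          ∀ x ∈ φ.source, ∀ a b : Euc q, g.inner x (F.coord φ a x) (F.coord φ b x) =
            fderiv ℝ (fun y => fderiv ℝ h y a) (φ x).2 b := by
  -- All parallel adapted charts with a Hessian potential are taken at once; their affine
  -- compatibility is automatic.
  refine ⟨{φ | IsAdaptedChart F.tangent φ ∧ D.IsParallelChart φ ∧ ∃ h : Euc q → ℝ,
    ContDiffOn ℝ ∞ h (Prod.snd '' φ.target) ∧ ∀ x ∈ φ.source, ∀ a b : Euc q,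
      g.inner x (F.coord φ a x) (F.coord φ b x) =
        fderiv ℝ (fun y => fderiv ℝ h y a) (φ x).2 b}, ⟨fun φ hφ => hφ.1, fun x => ?_, ?_⟩,
    fun φ hφ => hφ.2⟩
  · obtain ⟨ψ, hx, hψ, hpar, r, hr, ρ, hρ, ht⟩ :=
      NormalConnection.exists_isParallelChart h.foliated_connection.1 h.torsionFree hR x
    obtain ⟨f, hf, hfg⟩ := h.exists_hessian hψ hpar isOpen_ball (convex_ball _ _)
      ⟨_, mem_ball_self hr⟩ isOpen_ball (convex_ball _ _) ht
    refine ⟨ψ, ⟨hψ, hpar, f, hf.mono ?_, hfg⟩, hx⟩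
    rw [ht]
    exact snd_image_prod_subset _ _
  · intro φ hφ ψ hψ x hx
    exact NormalConnection.exists_affineEquiv_of_isParallelChart hφ.1 hψ.1 hφ.2.1 hψ.2.1 hx

end HessianCharts

/-! ### Smoothness of fields of linear maps, tested on sections -/

section HomBundle

open Bundle

variable {B F₁ F₂ : Type*} {E₁ E₂ : B → Type*} {n : WithTop ℕ∞}
  [∀ x, AddCommGroup (E₁ x)] [∀ x, Module ℝ (E₁ x)] [NormedAddCommGroup F₁] [NormedSpace ℝ F₁]
  [TopologicalSpace (TotalSpace F₁ E₁)] [∀ x, TopologicalSpace (E₁ x)]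
  [∀ x, IsTopologicalAddGroup (E₁ x)] [∀ x, ContinuousSMul ℝ (E₁ x)]
  [∀ x, AddCommGroup (E₂ x)] [∀ x, Module ℝ (E₂ x)] [NormedAddCommGroup F₂] [NormedSpace ℝ F₂]
  [TopologicalSpace (TotalSpace F₂ E₂)] [∀ x, TopologicalSpace (E₂ x)]
  [∀ x, IsTopologicalAddGroup (E₂ x)] [∀ x, ContinuousSMul ℝ (E₂ x)]
  {EB : Type*} [NormedAddCommGroup EB] [NormedSpace ℝ EB] {HB : Type*} [TopologicalSpace HB]
  {I : ModelWithCorners ℝ EB HB} [TopologicalSpace B] [ChartedSpace HB B]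
  [FiberBundle F₁ E₁] [VectorBundle ℝ F₁ E₁] [FiberBundle F₂ E₂] [VectorBundle ℝ F₂ E₂]
  [ContMDiffVectorBundle n F₁ E₁ I]

/-- A map into a space of linear maps on a finite-dimensional space is smooth if it is so
pointwise. -/
lemma contMDiffAt_clm_of_apply [FiniteDimensional ℝ F₁] {f : B → F₁ →L[ℝ] F₂} {x : B}
    (h : ∀ w, ContMDiffAt I 𝓘(ℝ, F₂) n (fun z => f z w) x) :
    ContMDiffAt I 𝓘(ℝ, F₁ →L[ℝ] F₂) n f x := by
  let b := Module.finBasis ℝ F₁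
  have hf : f = fun z => ∑ i, ContinuousLinearMap.smulRightL ℝ F₁ F₂
      (LinearMap.toContinuousLinearMap (b.coord i)) (f z (b i)) := by
    ext z w
    conv_lhs => rw [← b.sum_repr w, map_sum]
    simp
  rw [hf]
  exact contMDiffAt_finsetSum fun i _ => ContMDiffAt.comp x
    (ContinuousLinearMap.smulRightL ℝ F₁ F₂ _).contMDiff.contMDiffAt (h (b i))

/-- A field of linear maps between fibres of vector bundles is smooth if it takes smooth local
sections to smooth sections. -/
lemma contMDiffOn_hom_of_apply [FiniteDimensional ℝ F₁] {U : Set B} (hU : IsOpen U)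
    {ϕ : ∀ x, E₁ x →L[ℝ] E₂ x}
    (h : ∀ V, IsOpen V → V ⊆ U → ∀ s : ∀ x, E₁ x,
      ContMDiffOn I (I.prod 𝓘(ℝ, F₁)) n (fun x => TotalSpace.mk' F₁ x (s x)) V →
      ContMDiffOn I (I.prod 𝓘(ℝ, F₂)) n (fun x => TotalSpace.mk' F₂ x (ϕ x (s x))) V) :
    ContMDiffOn I (I.prod 𝓘(ℝ, F₁ →L[ℝ] F₂)) n
      (fun x => TotalSpace.mk' (F₁ →L[ℝ] F₂) (E := fun x => E₁ x →L[ℝ] E₂ x) x (ϕ x)) U := by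
  intro x hx
  refine ContMDiffAt.contMDiffWithinAt ?_
  rw [contMDiffAt_hom_bundle]
  refine ⟨contMDiffAt_id, contMDiffAt_clm_of_apply fun w => ?_⟩
  let e := trivializationAt F₁ E₁ x
  have hxe : x ∈ e.baseSet := FiberBundle.mem_baseSet_trivializationAt' x
  have hV : IsOpen (U ∩ e.baseSet) := hU.inter e.open_baseSet
  -- The test section has the constant value `w` in the trivialization at `x`.
  have h1 := h (U ∩ e.baseSet) hV inter_subset_left (fun z => e.symmL ℝ z w) (by
    rw [e.contMDiffOn_section_iff hV inter_subset_right]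
    refine contMDiffOn_const (c := w) |>.congr fun z hz => ?_
    rw [e.symmL_apply hz.2, e.apply_mk_symm hz.2])
  have h2 := (contMDiffAt_section x).1 (h1.contMDiffAt (hV.mem_nhds ⟨hx, hxe⟩))
  refine h2.congr_of_eventuallyEq ?_
  have h3 : ∀ᶠ z in 𝓝 x, z ∈ (trivializationAt F₂ E₂ x).baseSet :=
    (trivializationAt F₂ E₂ x).open_baseSet.mem_nhds (FiberBundle.mem_baseSet_trivializationAt' x)
  filter_upwards [h3] with z hz
  simp [ContinuousLinearMap.inCoordinates, e, Trivialization.coe_linearMapAt_of_mem _ hz]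

end HomBundle

/-! ### Extension of the transverse metric to a Riemannian metric -/

section TransverseMetric

variable {p q : ℕ} {M : Type*} [TopologicalSpace M] [ChartedSpace (Euc (p + q)) M]
  [IsManifold (𝓡 (p + q)) ∞ M] {F : Foliation p q M}

/-- A positive definite bilinear form on a finite-dimensional space has a bounded unit ball. -/
lemma isVonNBounded_of_posDef {E : Type*} [NormedAddCommGroup E] [NormedSpace ℝ E]
    [FiniteDimensional ℝ E] (B : E →L[ℝ] E →L[ℝ] ℝ) (hB : ∀ v, v ≠ 0 → 0 < B v v) :
    Bornology.IsVonNBounded ℝ {v | B v v < 1} := by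
  rw [NormedSpace.isVonNBounded_iff]
  have hcont : Continuous fun v => B v v := by fun_prop
  obtain ⟨m, hm, hmB⟩ : ∃ m > 0, ∀ v ∈ Metric.sphere (0 : E) 1, m ≤ B v v :=
    (isCompact_sphere 0 1).exists_forall_le' hcont.continuousOn fun v hv =>
      hB v (ne_zero_of_mem_unit_sphere ⟨v, hv⟩)
  -- With `m` a positive lower bound for the form on the unit sphere, `‖v‖ ^ 2 < 1 / m`; the crude
  -- radius avoids a square root, since `2 * ‖v‖ ≤ 1 + ‖v‖ ^ 2`.
  refine (Metric.isBounded_ball (x := (0 : E)) (r := 1 + 1 / m)).subset fun v hv => ?_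
  rw [mem_ball_zero_iff]
  by_cases h0 : v = 0
  · rw [h0, norm_zero]; positivity
  have hn : 0 < ‖v‖ := norm_pos_iff.2 h0
  have h1 := hmB (‖v‖⁻¹ • v) (by
    rw [mem_sphere_zero_iff_norm, norm_smul, norm_inv, norm_norm, inv_mul_cancel₀ hn.ne'])
  have h2 : B v v < 1 := hv
  simp only [map_smul, _root_.smul_apply, smul_eq_mul] at h1
  have h3 : m * ‖v‖ ^ 2 ≤ B v v := by
    have := mul_le_mul_of_nonneg_right h1 (sq_nonneg ‖v‖)
    field_simp at this
    linarith
  have h4 : ‖v‖ ^ 2 < 1 / m := by rw [lt_div_iff₀ hm]; linarith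
  nlinarith [sq_nonneg (‖v‖ - 1)]

variable [T2Space M] [SigmaCompactSpace M]

/-- There is a smooth field of projections onto the tangent spaces of the leaves. -/
lemma Foliation.exists_projection (F : Foliation p q M) :
    ∃ P : ∀ x : M, TangentSpace (𝓡 (p + q)) x →L[ℝ] TangentSpace (𝓡 (p + q)) x,
      (∀ U X, IsSmoothField U X → IsSmoothField U fun x => P x (X x)) ∧
      ∀ x, (∀ v, P x v ∈ F.tangent x) ∧ ∀ v ∈ F.tangent x, P x v = v := by
  suffices h : ∃ s : ContMDiffSection (𝓡 (p + q)) (Euc (p + q) →L[ℝ] Euc (p + q)) ∞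
      (fun x : M => TangentSpace (𝓡 (p + q)) x →L[ℝ] TangentSpace (𝓡 (p + q)) x),
      ∀ x, (∀ v, s x v ∈ F.tangent x) ∧ ∀ v ∈ F.tangent x, s x v = v by
    obtain ⟨s, hs⟩ := h
    refine ⟨s, fun U X hX => ?_, hs⟩
    exact ContMDiffOn.clm_bundle_apply (b := id) s.contMDiff.contMDiffOn hX
  -- Projections onto a fixed subspace form a convex set, so coordinate projections glue by a
  -- partition of unity.
  refine exists_contMDiffSection_forall_mem_convex_of_local (n := ⊤) (𝓡 (p + q))
    (F_fiber := Euc (p + q) →L[ℝ] Euc (p + q))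
    (fun x : M => TangentSpace (𝓡 (p + q)) x →L[ℝ] TangentSpace (𝓡 (p + q)) x)
    (fun x => {P | (∀ v, P v ∈ F.tangent x) ∧ ∀ v ∈ F.tangent x, P v = v})
    (fun x P hP Q hQ a b _ _ hab => ⟨fun v => ?_, fun v hv => ?_⟩) fun x₀ => ?_
  · exact add_mem (Submodule.smul_mem _ _ (hP.1 v)) (Submodule.smul_mem _ _ (hQ.1 v))
  · change a • P v + b • Q v = v
    rw [hP.2 v hv, hQ.2 v hv, ← add_smul, hab, one_smul]
  · obtain ⟨φ, hx, hφ⟩ := F.exists_chart x₀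
    let L : Euc p × Euc q →L[ℝ] Euc p × Euc q :=
      (ContinuousLinearMap.inl ℝ _ _).comp (ContinuousLinearMap.fst ℝ _ _)
    have hloc : ∀ z ∈ φ.source, (∀ v : TangentSpace (𝓡 (p + q)) z,
        coordVec φ (L (vecDeriv φ z v)) z ∈ F.tangent z) ∧
        ∀ v ∈ F.tangent z, coordVec φ (L (vecDeriv φ z v)) z = v := by
      refine fun z hz => ⟨fun v => hφ.coordVec_left_mem hz _, fun v hv => ?_⟩
      have h1 := (hφ.mem_tangent_iff hz v).1 hv
      rw [hφ.transv_eq hz] at h1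
      have h2 : L (vecDeriv φ z v) = vecDeriv φ z v := Prod.ext rfl h1.symm
      rw [h2, hφ.isSmoothChart.coordVec_vecDeriv hz]
    let K : ∀ z : M, TangentSpace (𝓡 (p + q)) z →L[ℝ] TangentSpace (𝓡 (p + q)) z := fun z =>
      (mfderiv 𝓘(ℝ, Euc p × Euc q) (𝓡 (p + q)) φ.symm (φ z)).comp (L.comp (vecDeriv φ z))
    refine ⟨φ.source, φ.open_source.mem_nhds hx, K, ?_, hloc⟩
    refine contMDiffOn_hom_of_apply (ϕ := K) φ.open_source fun V hV hVφ X hX => ?_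
    have hX' : IsSmoothField V X := hX
    exact hφ.isSmoothChart.isSmoothField_coordVec hVφ (L.contMDiff.comp_contMDiffOn
      (hX'.contMDiffOn_vecDeriv hV (hφ.contMDiffOn.mono hVφ)))

/-- The metric of the normal bundle is the horizontal part of a Riemannian metric. -/
lemma NormalMetric.exists_hasHorizontalPart (g : NormalMetric F) :
    ∃ G : Bundle.ContMDiffRiemannianMetric (𝓡 (p + q)) ∞ (Euc (p + q))
      (fun x : M => TangentSpace (𝓡 (p + q)) x), HasHorizontalPart G g := by
  obtain ⟨P, hPs, hP⟩ := F.exists_projection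
  -- Orthogonal complements vary with the metric and do not average well. Prescribing the complement
  -- as the kernel of `P` beforehand turns the requirements into convex conditions on `B`.
  suffices h : ∃ B : ContMDiffSection (𝓡 (p + q)) (Euc (p + q) →L[ℝ] Euc (p + q) →L[ℝ] ℝ) ∞
      (fun x : M => TangentSpace (𝓡 (p + q)) x →L[ℝ] TangentSpace (𝓡 (p + q)) x →L[ℝ] ℝ),
      ∀ x, (∀ v w, B x v w = B x w v) ∧ (∀ v, v ≠ 0 → 0 < B x v v) ∧
        (∀ u ∈ F.tangent x, ∀ w, P x w = 0 → B x u w = 0) ∧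
        ∀ v w, P x v = 0 → P x w = 0 →
          B x v w = g.inner x ((F.tangent x).mkQ v) ((F.tangent x).mkQ w) by
    obtain ⟨B, hB⟩ := h
    refine ⟨⟨fun x => B x, fun x => (hB x).1, fun x => (hB x).2.1, fun x => ?_, B.contMDiff⟩,
      fun x v w hv hw => ?_⟩
    · exact isVonNBounded_of_posDef (E := Euc (p + q)) (B x) (hB x).2.1
    -- A vector `v` orthogonal to the leaf satisfies `0 = B(Pv, v) = B(Pv, Pv)`, so it lies in the
    -- kernel of `P`.
    · have hproj : ∀ v, (∀ u ∈ F.tangent x, B x u v = 0) → P x v = 0 := by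
        intro v hv
        have h1 : P x (v - P x v) = 0 := by
          rw [map_sub, (hP x).2 _ ((hP x).1 v), sub_self]
        have h2 : B x (P x v) v = B x (P x v) (v - P x v) + B x (P x v) (P x v) := by
          rw [map_sub, sub_add_cancel]
        rw [hv _ ((hP x).1 v), (hB x).2.2.1 _ ((hP x).1 v) _ h1, zero_add] at h2
        by_contra h0
        exact ((hB x).2.1 _ h0).ne h2
      exact (hB x).2.2.2 v w (hproj v hv) (hproj w hw)
  refine exists_contMDiffSection_forall_mem_convex_of_local (n := ⊤) (𝓡 (p + q))
    (F_fiber := Euc (p + q) →L[ℝ] Euc (p + q) →L[ℝ] ℝ)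
    (fun x : M => TangentSpace (𝓡 (p + q)) x →L[ℝ] TangentSpace (𝓡 (p + q)) x →L[ℝ] ℝ)
    (fun x => {B | (∀ v w, B v w = B w v) ∧ (∀ v, v ≠ 0 → 0 < B v v) ∧
      (∀ u ∈ F.tangent x, ∀ w, P x w = 0 → B u w = 0) ∧
      ∀ v w, P x v = 0 → P x w = 0 →
        B v w = g.inner x ((F.tangent x).mkQ v) ((F.tangent x).mkQ w)})
    (fun x B hB C hC a b ha hb hab => ⟨fun v w => ?_, fun v hv => ?_, fun u hu w hw => ?_,
      fun v w hv hw => ?_⟩) fun x₀ => ?_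
  · change a • B v w + b • C v w = a • B w v + b • C w v
    rw [hB.1, hC.1]
  · change 0 < a * B v v + b * C v v
    have h1 := hB.2.1 v hv
    have h2 := hC.2.1 v hv
    rcases ha.eq_or_lt with rfl | ha
    · rw [zero_add] at hab
      rw [hab]
      linarith
    · have := mul_pos ha h1
      have := mul_nonneg hb h2.le
      linarith
  · change a • B u w + b • C u w = 0
    rw [hB.2.2.1 u hu w hw, hC.2.2.1 u hu w hw, smul_zero, smul_zero, add_zero]
  · change a • B v w + b • C v w = _
    rw [hB.2.2.2 v w hv hw, hC.2.2.2 v w hv hw, ← add_smul, hab, one_smul]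
  · obtain ⟨φ, hx, hφ⟩ := F.exists_chart x₀
    -- The local model is the Euclidean product of the leafwise coordinates of `P v` plus `g` on
    -- classes; it splits along the image and the kernel of `P`.
    let A : ∀ z : M, TangentSpace (𝓡 (p + q)) z →L[ℝ] Euc p := fun z =>
      (ContinuousLinearMap.fst ℝ (Euc p) (Euc q)).comp ((vecDeriv φ z).comp (P z))
    let C : ∀ z : M, TangentSpace (𝓡 (p + q)) z →L[ℝ] TangentSpace (𝓡 (p + q)) z →L[ℝ] ℝ :=
      fun z => bilinearToCLM (q := p + q)
        ((innerₗ (Euc p)).compl₁₂ (A z).toLinearMap (A z).toLinearMap +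
          (g.inner z).compl₁₂ (F.tangent z).mkQ (F.tangent z).mkQ)
    have hC : ∀ z v w, C z v w = Inner.inner ℝ (A z v) (A z w) +
      g.inner z ((F.tangent z).mkQ v) ((F.tangent z).mkQ w) := fun _ _ _ => rfl
    have hA0 : ∀ z v, P z v = 0 → A z v = 0 := fun z v hv => by
      change (vecDeriv φ z (P z v)).1 = 0
      rw [hv, map_zero]
      rfl
    refine ⟨φ.source, φ.open_source.mem_nhds hx, C, ?_, fun z hz =>
      ⟨fun v w => ?_, fun v hv => ?_, fun u hu w hw => ?_, fun v w hv hw => ?_⟩⟩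
    · have hAs : ∀ V, IsOpen V → V ⊆ φ.source → ∀ X, IsSmoothField V X →
          ContMDiffOn (𝓡 (p + q)) 𝓘(ℝ, Euc p) ∞ (fun z => A z (X z)) V := by
        intro V hV hVφ X hX
        exact (ContinuousLinearMap.fst ℝ (Euc p) (Euc q)).contMDiff.comp_contMDiffOn
          ((hPs V X hX).contMDiffOn_vecDeriv hV (hφ.contMDiffOn.mono hVφ))
      refine contMDiffOn_hom_of_apply φ.open_source fun V hV hVφ X hX => ?_
      refine contMDiffOn_hom_of_apply hV fun W hW hWV Y hY => ?_
      have hX' : IsSmoothField W X := ContMDiffOn.mono hX hWV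
      have hbar : ∀ X, IsSmoothField W X → F.IsSmoothSection W (F.bar X) := fun X hX z hz =>
        ⟨W, hW, hz, subset_rfl, X, hX, fun _ _ => rfl⟩
      have h1 : ContMDiffOn (𝓡 (p + q)) 𝓘(ℝ, ℝ) ∞ (fun z => C z (X z) (Y z)) W :=
        ((contDiff_inner (𝕜 := ℝ) (E := Euc p)).contMDiff.comp_contMDiffOn
          ((hAs W hW (hWV.trans hVφ) X hX').prodMk_space (hAs W hW (hWV.trans hVφ) Y hY))).add
          (g.smooth W hW _ _ (hbar X hX') (hbar Y hY))
      exact fun z hz => Bundle.contMDiffWithinAt_section.2 (h1 z hz)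
    · rw [hC, hC, real_inner_comm, g.symm]
    · rw [hC]
      -- For leaf vectors `P v = v` and `dy(v) = 0`, so the leafwise coordinates alone detect `v`;
      -- otherwise the `g` term is positive.
      by_cases hvT : (F.tangent z).mkQ v = 0
      · have hvm : v ∈ F.tangent z := by simpa using hvT
        rw [hvT, map_zero, add_zero]
        refine real_inner_self_pos.2 fun h0 => hv ?_
        have h1 : (vecDeriv φ z (P z v)).1 = 0 := h0
        rw [(hP z).2 v hvm] at h1
        have h2 := (hφ.mem_tangent_iff hz v).1 hvm
        rw [hφ.transv_eq hz] at h2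
        have h3 : vecDeriv φ z v = 0 := Prod.ext h1 h2
        rw [← hφ.isSmoothChart.coordVec_vecDeriv hz v, h3]
        exact map_zero (mfderiv 𝓘(ℝ, Euc p × Euc q) (𝓡 (p + q)) φ.symm (φ z))
      · exact add_pos_of_nonneg_of_pos real_inner_self_nonneg (g.pos z _ hvT)
    · have hu0 : (F.tangent z).mkQ u = 0 := by simpa using hu
      rw [hC, hA0 z w hw, hu0, inner_zero_right, map_zero, zero_add]
      rfl
    · rw [hC, hA0 z w hw, inner_zero_right, zero_add]

end TransverseMetric

theorem mainTheorem6 (p q : ℕ) (M : Type*) [TopologicalSpace M] [T2Space M] [SigmaCompactSpace M]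
    [ChartedSpace (Euc (p + q)) M] [IsManifold (𝓡 (p + q)) ∞ M] (F : Foliation p q M)
    (D : NormalConnection F) (g : NormalMetric F) (hDg : IsFoliatedCodazzi D g) :
    HasConstantCurvature D g 0 ↔ IsTransverselyHessian D g := by
  refine ⟨fun hR => ⟨hDg.exists_atlas hR, g.exists_hasHorizontalPart⟩, ?_⟩
  -- Curvature at `x` is a local matter, so one parallel chart around `x` suffices.
  rintro ⟨⟨A, hA, hAg⟩, -⟩ U hU X Y s hX hY hs x hx
  obtain ⟨φ, hφ, hxφ⟩ := hA.covers x
  rw [zero_smul]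
  exact NormalConnection.curvature_eq_zero_of_isParallelChart (hA.adapted φ hφ) (hAg φ hφ).1 hU
    hx hxφ hX hY hs
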